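/- Let $\mathbb K=\mathbb R$ or $\mathbb C$ and let $n,r,s,q\ge 0$ be integers, $\mathbf m=(m_1,\dots,m_r)\in\mathbb N^r$. Let $\mathbb A_n$ be the space of germs at $0\in\mathbb K^n$ of analytic functions, identified with their (convergent) Taylor series; for $d\geq 0$ let $(\mathbb A_n^k)^{(d)}$ be the space of $k$-tuples of homogeneous polynomials of degree $d$, and $(\mathbb A_n^k)_{>d}$ the space of $k$-tuples of analytic germs with zero $d$-jet at $0$. For a homogeneous polynomial $f=\sum_{|\alpha|=d}f_\alpha x^\alpha$ put $\|f\|=\sum_{|\alpha|=d}|f_\alpha|$, and for a tuple put $\|(f_1,\dots,f_k)\|=\max_j\|f_j\|$. Put $$\mathcal F^{>i}=\prod_{j=1}^r(\mathbb A_n)_{>m_j+i}\ (i\ge 0),\qquad \mathcal F^{(i)}=\prod_{j=1}^r(\mathbb A_n)^{(m_j+i)}\ (i\ge 1),$$ and let $\widehat{\mathcal F}^{>0}$ be the space of $r$-tuples $F$ of formal power series with $\operatorname{ord}_0F_j\ge m_j+1$ for all $j$. Nonzero elements of $\mathcal F^{>0}$ have the order given by this filtration: $\operatorname{ord}_0F\ge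 i+1$ means $F\in\mathcal F^{>i}$. Fix $P\in(\mathbb A_n^s)^{(q)}$ and the affine space $\mathcal A_P=P+(\mathbb A_n^s)_{>q}$. Let the pseudo-group $\mathcal G=\mathrm{id}+\mathcal F^{>0}$ act on $\mathcal A_P$ by maps $X\mapsto(\mathrm{id}+F)_*X$, $F\in\mathcal F^{>0}$ (nothing about the composition law of $\mathcal G$ is needed). Let $\mathcal S:\mathcal F^{>0}\to\mathbb A_n^s$ be a linear map that depends only on $P$, and suppose the following. 1. (Filtering.) $\mathcal S(\mathcal F^{(i)})\subseteq(\mathbb A_n^s)^{(q+i)}$ for $i\ge1$ and $\mathcal S(\mathcal F^{>i})\subseteq(\mathbb A_n^s)_{>q+i}$ for $i\ge0$; and, writing $(\mathrm{id}+F)_*(P+R)=P+R+\mathcal S(F)+\mathcal T(R;F)$, one has $\mathcal T(R;0)=0$ and $\operatorname{ord}_0(\mathcal T(R;F)-\mathcal T(R;G))>\operatorname{ord}_0(F-G)+q$ for all $R\in(\mathbb A_n^s)_{>q}$ and all $F, G\in\mathcal F^{>0}$ (with $\operatorname{ord}_0 0=\infty$, for $F\ne G$). 2. (Analytic differential of order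 $\mathbf m$, and regular.) For every $X\in\mathcal A_P$ there is a germ at $0$ of an analytic map $W=(W_1,\dots,W_s)$ of the variables $x\in\mathbb K^n$ and $u=(u_{j,\alpha})_{1\le j\le r,\,|\alpha|\le m_j}$ with $W(x,0)=0$ such that, for every $F\in\mathcal F^{>0}$, as germs at $0$, $$(\mathrm{id}+F)_*X=X+\mathcal S(F)+W(x,\partial F),\qquad \partial F=\big(\partial^{\alpha}F_j\big)_{1\le j\le r,\,|\alpha|\le m_j},$$ and such that for every $F\in\widehat{\mathcal F}^{>0}$ and all $l,j,\alpha$ $$\operatorname{ord}_0\Big(\frac{\partial W_l}{\partial u_{j,\alpha}}(x,\partial F)\Big)\ge\max(0,|\alpha|+q+1-m_j).$$ For $i\geq 1$ let $\mathcal S^{(i)}:\mathcal F^{(i)}\to(\mathbb A_n^s)^{(q+i)}$ be the restriction of $\mathcal S$, let $\mathcal N^{(q+i)}$ be any linear subspace with $(\mathbb A_n^s)^{(q+i)}=\operatorname{Im}\mathcal S^{(i)}\oplus\mathcal N^{(q+i)}$, let $\pi_{\mathcal N}^{(q+i)}$ be the projection onto $\operatorname{Im}\mathcal S^{(i)}$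 along $\mathcal N^{(q+i)}$, and let $\widehat{\mathcal N}=\mathcal N^{(q+1)}\oplus\mathcal N^{(q+2)}\oplus\cdots$ (formal infinite sums). Assume that there is a constant $C>0$ such that for every $i\ge1$ and every $A\in(\mathbb A_n^s)^{(q+i)}$ the equation $$\mathcal S^{(i)}(F)=\pi_{\mathcal N}^{(q+i)}(A)$$ has a solution $F=(F_1,\dots,F_r)\in\mathcal F^{(i)}$ with $$\|F_j\|\le C\,\frac{\|A\|}{i^{m_j}},\qquad j=1,\dots,r.$$ Then the formal normal form $P+\widehat{\mathcal N}$ holds in the analytic category: for every $R\in(\mathbb A_n^s)_{>q}$ there is $\Phi\in\mathcal G$ such that $\Phi_*(P+R)-P\in\widehat{\mathcal N}\cap(\mathbb A_n^s)_{>q}$. -/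

import Mathlib

noncomputable section

namespace AnalyticNormalForm

open MvPowerSeries

/-! ### Formal power series, germs of analytic maps, norms

Germs at `0` of analytic functions of `n` variables over `𝕜` (real or complex) are represented by
their Taylor series, i.e. by the convergent power series. -/

/-- `k`-tuples of formal power series in `n` variables. -/
abbrev FormalTuple (𝕜 : Type*) (n k : ℕ) : Type _ := Fin k → MvPowerSeries (Fin n) 𝕜

/-- The norm of the homogeneous part of degree `d`: the sum of the absolute values of the
coefficients of all monomials of total degree `d`. -/
def homNorm {𝕜 : Type*} [RCLike 𝕜] {σ : Type*} [Fintype σ] [DecidableEq σ]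
    (d : ℕ) (f : MvPowerSeries σ 𝕜) : ℝ :=
  ∑ α ∈ (Finset.univ : Finset σ).finsuppAntidiag d, ‖coeff α f‖

/-- The norm of the homogeneous part of degree `d` of a tuple: the maximum of the norms of the
components. -/
def tupleNorm {𝕜 : Type*} [RCLike 𝕜] {n k : ℕ} (d : ℕ) (f : FormalTuple 𝕜 n k) : ℝ :=
  ⨆ j : Fin k, homNorm d (f j)

/-- A power series converges near `0` (is the Taylor series of an analytic germ) iff its
homogeneous parts grow at most geometrically. -/
def IsConvergent {𝕜 : Type*} [RCLike 𝕜] {σ : Type*} [Fintype σ] [DecidableEq σ]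
    (f : MvPowerSeries σ 𝕜) : Prop :=
  ∃ M ρ : ℝ, 0 < M ∧ 0 < ρ ∧ ∀ d : ℕ, homNorm d f ≤ M * (1 / ρ) ^ d

section Convergent

variable {𝕜 : Type*} [RCLike 𝕜] {σ : Type*} [Fintype σ] [DecidableEq σ]

theorem homNorm_nonneg (d : ℕ) (f : MvPowerSeries σ 𝕜) : 0 ≤ homNorm d f :=
  Finset.sum_nonneg fun _ _ => norm_nonneg _

theorem homNorm_add_le (d : ℕ) (f g : MvPowerSeries σ 𝕜) :
    homNorm d (f + g) ≤ homNorm d f + homNorm d g := by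
  unfold homNorm
  rw [← Finset.sum_add_distrib]
  exact Finset.sum_le_sum fun α _ => by rw [map_add]; exact norm_add_le _ _

theorem homNorm_smul (d : ℕ) (c : 𝕜) (f : MvPowerSeries σ 𝕜) :
    homNorm d (c • f) = ‖c‖ * homNorm d f := by
  unfold homNorm
  rw [Finset.mul_sum]
  exact Finset.sum_congr rfl fun α _ => by simp

theorem homNorm_zero (d : ℕ) : homNorm d (0 : MvPowerSeries σ 𝕜) = 0 := by
  simp [homNorm]

theorem IsConvergent.zero : IsConvergent (0 : MvPowerSeries σ 𝕜) :=
  ⟨1, 1, one_pos, one_pos, fun d => by simp [homNorm_zero]⟩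

theorem IsConvergent.add {f g : MvPowerSeries σ 𝕜} (hf : IsConvergent f) (hg : IsConvergent g) :
    IsConvergent (f + g) := by
  obtain ⟨M, ρ, hM, hρ, h⟩ := hf
  obtain ⟨M', ρ', hM', hρ', h'⟩ := hg
  refine ⟨M + M', min ρ ρ', by positivity, lt_min hρ hρ', fun d => ?_⟩
  have hmin : 0 < min ρ ρ' := lt_min hρ hρ'
  have h1 : (1 / ρ) ^ d ≤ (1 / min ρ ρ') ^ d :=
    pow_le_pow_left₀ (by positivity) (one_div_le_one_div_of_le hmin (min_le_left _ _)) d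
  have h2 : (1 / ρ') ^ d ≤ (1 / min ρ ρ') ^ d :=
    pow_le_pow_left₀ (by positivity) (one_div_le_one_div_of_le hmin (min_le_right _ _)) d
  calc homNorm d (f + g) ≤ homNorm d f + homNorm d g := homNorm_add_le d f g
    _ ≤ M * (1 / ρ) ^ d + M' * (1 / ρ') ^ d := add_le_add (h d) (h' d)
    _ ≤ M * (1 / min ρ ρ') ^ d + M' * (1 / min ρ ρ') ^ d := by gcongr
    _ = (M + M') * (1 / min ρ ρ') ^ d := by ring

theorem IsConvergent.smul (c : 𝕜) {f : MvPowerSeries σ 𝕜} (hf : IsConvergent f) :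
    IsConvergent (c • f) := by
  obtain ⟨M, ρ, hM, hρ, h⟩ := hf
  refine ⟨(‖c‖ + 1) * M, ρ, by positivity, hρ, fun d => ?_⟩
  rw [homNorm_smul]
  have h0 := homNorm_nonneg d f
  have : 0 ≤ M * (1 / ρ) ^ d := by positivity
  nlinarith [h d, norm_nonneg c]

theorem degree_of_mem_antidiag {d : ℕ} {α : σ →₀ ℕ}
    (h : α ∈ (Finset.univ : Finset σ).finsuppAntidiag d) : α.degree = d := by
  rw [Finset.mem_finsuppAntidiag] at h
  rw [Finsupp.degree_eq_sum]
  exact h.1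

/-- Homogeneous polynomials are convergent. -/
theorem IsConvergent.of_isHomogeneous {f : MvPowerSeries σ 𝕜} {p : ℕ} (hf : f.IsHomogeneous p) :
    IsConvergent f := by
  refine ⟨homNorm p f + 1, 1, by have := homNorm_nonneg p f; positivity, one_pos, fun d => ?_⟩
  have h0 := homNorm_nonneg p f
  by_cases hd : d = p
  · subst hd; simp
  · have : homNorm d f = 0 := Finset.sum_eq_zero fun α hα => by
      rw [hf.coeff_eq_zero (by rw [degree_of_mem_antidiag hα]; exact hd), norm_zero]
    rw [this]; simp; linarith

end Convergent

/-! ### The spaces of tuples -/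

/-- `k`-tuples of germs of analytic functions of `n` variables. -/
def analyticTuples (𝕜 : Type*) [RCLike 𝕜] (n k : ℕ) : Submodule 𝕜 (FormalTuple 𝕜 n k) where
  carrier := {f | ∀ j, IsConvergent (f j)}
  zero_mem' := fun _ => IsConvergent.zero
  add_mem' := fun hf hg j => (hf j).add (hg j)
  smul_mem' := fun c _ hf j => (hf j).smul c

/-- Tuples of formal power series whose `j`-th component has order `> d j` (zero `d j`-jet). -/
def formalGT (𝕜 : Type*) [RCLike 𝕜] (n : ℕ) {k : ℕ} (d : Fin k → ℕ) :
    Submodule 𝕜 (FormalTuple 𝕜 n k) where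
  carrier := {f | ∀ j, (d j : ℕ∞) < (f j).order}
  zero_mem' := fun j => by simp
  add_mem' := fun {f g} hf hg j => lt_of_lt_of_le (lt_min (hf j) (hg j)) min_order_le_add
  smul_mem' := fun _ _ hf j => lt_of_lt_of_le (hf j) le_order_smul

/-- Tuples of analytic germs whose `j`-th component has zero `d j`-jet. -/
def germGT (𝕜 : Type*) [RCLike 𝕜] (n : ℕ) {k : ℕ} (d : Fin k → ℕ) :
    Submodule 𝕜 (FormalTuple 𝕜 n k) :=
  analyticTuples 𝕜 n k ⊓ formalGT 𝕜 n d

/-- Tuples whose `j`-th component is a homogeneous polynomial of degree `d j`. -/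
def homog (𝕜 : Type*) [RCLike 𝕜] (n : ℕ) {k : ℕ} (d : Fin k → ℕ) :
    Submodule 𝕜 (FormalTuple 𝕜 n k) where
  carrier := {f | ∀ j, (f j).IsHomogeneous (d j)}
  zero_mem' := fun j => by
    rw [Pi.zero_apply, isHomogeneous_iff_eq_homogeneousComponent, map_zero]
  add_mem' := fun hf hg j => IsHomogeneous.add (hf j) (hg j)
  smul_mem' := fun c f hf j => by
    have h : (f j).IsHomogeneous (d j) := hf j
    rw [isHomogeneous_iff_eq_homogeneousComponent] at h
    rw [Pi.smul_apply, isHomogeneous_iff_eq_homogeneousComponent, map_smul, ← h]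

/-- The filtration `𝓕^{>i} = (𝔸_n)_{>i+m_1} × ⋯ × (𝔸_n)_{>i+m_r}`. -/
abbrev FGT (𝕜 : Type*) [RCLike 𝕜] (n : ℕ) {r : ℕ} (m : Fin r → ℕ) (i : ℕ) :
    Submodule 𝕜 (FormalTuple 𝕜 n r) :=
  germGT 𝕜 n fun j => m j + i

/-- The graded pieces `𝓕^{(i)} = (𝔸_n)^{(m_1+i)} × ⋯ × (𝔸_n)^{(m_r+i)}`. -/
abbrev FHom (𝕜 : Type*) [RCLike 𝕜] (n : ℕ) {r : ℕ} (m : Fin r → ℕ) (i : ℕ) :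
    Submodule 𝕜 (FormalTuple 𝕜 n r) :=
  homog 𝕜 n fun j => m j + i

/-- `(𝔸_n^s)_{>d}`. -/
abbrev AGT (𝕜 : Type*) [RCLike 𝕜] (n s d : ℕ) : Submodule 𝕜 (FormalTuple 𝕜 n s) :=
  germGT 𝕜 n fun _ : Fin s => d

/-- `(𝔸_n^s)^{(d)}`. -/
abbrev AHom (𝕜 : Type*) [RCLike 𝕜] (n s d : ℕ) : Submodule 𝕜 (FormalTuple 𝕜 n s) :=
  homog 𝕜 n fun _ : Fin s => d

/-- `𝓕^{(i)} ⊆ 𝓕^{>0}` for `i ≥ 1`. -/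
theorem FHom_le_FGT (𝕜 : Type*) [RCLike 𝕜] (n : ℕ) {r : ℕ} (m : Fin r → ℕ) {i : ℕ}
    (hi : 1 ≤ i) : FHom 𝕜 n m i ≤ FGT 𝕜 n m 0 := by
  intro F hF
  refine ⟨fun j => IsConvergent.of_isHomogeneous (hF j), fun j => ?_⟩
  have h1 : m j + 0 < m j + i := by omega
  refine lt_of_lt_of_le (b := ((m j + i : ℕ) : ℕ∞)) (by exact_mod_cast h1) ?_
  exact nat_le_order fun α hα => IsHomogeneous.coeff_eq_zero (hF j) hα.ne

/-- The homogeneous part of degree `d` of a tuple of formal power series. -/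
def homPart {𝕜 : Type*} [RCLike 𝕜] {n s : ℕ} (d : ℕ) (f : FormalTuple 𝕜 n s) : AHom 𝕜 n s d :=
  ⟨fun j => homogeneousComponent d (f j), fun j => isHomogeneous_homogeneousComponent (f j) d⟩

/-- The affine space `P + (𝔸_n^s)_{>q}`. -/
abbrev AffineGerms {𝕜 : Type*} [RCLike 𝕜] {n s : ℕ} (q : ℕ) (P : FormalTuple 𝕜 n s) : Type _ :=
  {X : FormalTuple 𝕜 n s // X - P ∈ AGT 𝕜 n s q}

/-! ### Jets -/

/-- The coordinates `u_{j,α}`, `|α| ≤ m_j`, on the space of `m`-jets. -/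
abbrev JetCoord (n : ℕ) {r : ℕ} (m : Fin r → ℕ) : Type :=
  Σ j : Fin r, {α : Fin n →₀ ℕ // α.degree ≤ m j}

instance instFintypeDegreeLE (n d : ℕ) : Fintype {α : Fin n →₀ ℕ // α.degree ≤ d} :=
  (Finsupp.finite_of_degree_le (σ := Fin n) d).fintype

/-- The coordinates `(x, u)` on the space of `m`-jets. -/
abbrev JetVar (n : ℕ) {r : ℕ} (m : Fin r → ℕ) : Type := Fin n ⊕ JetCoord n m

/-- The iterated partial derivative `∂^{|α|} f / ∂x^α`. -/
def iterPDeriv {𝕜 : Type*} [RCLike 𝕜] {n : ℕ} (α : Fin n →₀ ℕ) (f : MvPowerSeries (Fin n) 𝕜) :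
    MvPowerSeries (Fin n) 𝕜 :=
  fun β => (∏ i, ((β i + α i).descFactorial (α i) : 𝕜)) * coeff (β + α) f

theorem coeff_iterPDeriv {𝕜 : Type*} [RCLike 𝕜] {n : ℕ} (α β : Fin n →₀ ℕ)
    (f : MvPowerSeries (Fin n) 𝕜) :
    coeff β (iterPDeriv α f) =
      (∏ i, ((β i + α i).descFactorial (α i) : 𝕜)) * coeff (β + α) f := rfl

theorem iterPDeriv_zero {𝕜 : Type*} [RCLike 𝕜] {n : ℕ} (f : MvPowerSeries (Fin n) 𝕜) :
    iterPDeriv 0 f = f := by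
  ext β; simp [coeff_iterPDeriv]

/-- `∂^{α + e_i} = ∂_i ∂^α`, so that `iterPDeriv` is the iteration of `MvPowerSeries.pderiv`. -/
theorem iterPDeriv_add_single {𝕜 : Type*} [RCLike 𝕜] {n : ℕ} (α : Fin n →₀ ℕ) (i : Fin n)
    (f : MvPowerSeries (Fin n) 𝕜) :
    iterPDeriv (α + Finsupp.single i 1) f = pderiv 𝕜 i (iterPDeriv α f) := by
  ext β
  rw [coeff_pderiv, coeff_iterPDeriv, coeff_iterPDeriv]
  have h1 : β + (α + Finsupp.single i 1) = β + Finsupp.single i 1 + α := by abel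
  set e : Fin n →₀ ℕ := Finsupp.single i 1 with he
  have h2 : (∏ l, (((β l + (α + e) l).descFactorial
        ((α + e) l) : ℕ) : 𝕜)) =
      (∏ l, ((((β + e) l + α l).descFactorial (α l) : ℕ) : 𝕜)) * (β i + 1) := by
    rw [← Finset.mul_prod_erase _ _ (Finset.mem_univ i),
      ← Finset.mul_prod_erase (a := i) _ (fun l => ((((β + e) l +
        α l).descFactorial (α l) : ℕ) : 𝕜)) (Finset.mem_univ i)]
    have h3 : ∀ l ∈ (Finset.univ : Finset (Fin n)).erase i,
        (((β l + (α + e) l).descFactorial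
          ((α + e) l) : ℕ) : 𝕜) =
        ((((β + e) l + α l).descFactorial (α l) : ℕ) : 𝕜) := by
      intro l hl
      have : i ≠ l := (Finset.ne_of_mem_erase hl).symm
      simp [he, this]
    rw [Finset.prod_congr rfl h3]
    have h4 : (((β i + (α + e) i).descFactorial
          ((α + e) i) : ℕ) : 𝕜) =
        ((((β + e) i + α i).descFactorial (α i) : ℕ) : 𝕜) * (β i + 1) := by
      simp only [he, Finsupp.add_apply, Finsupp.single_eq_same]
      rw [Nat.descFactorial_succ]
      have e1 : β i + (α i + 1) - α i = β i + 1 := by omega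
      have e2 : β i + (α i + 1) = β i + 1 + α i := by omega
      rw [e1, e2]; push_cast; ring
    rw [h4]; ring
  rw [h1, h2]; ring

/-- The jet extension `(x, ∂F)` of a tuple `F`: the list of power series to be substituted for the
jet coordinates `(x, u)`. -/
def jet {𝕜 : Type*} [RCLike 𝕜] {n r : ℕ} (m : Fin r → ℕ) (F : FormalTuple 𝕜 n r) :
    JetVar n m → MvPowerSeries (Fin n) 𝕜
  | Sum.inl i => X i
  | Sum.inr u => iterPDeriv u.2.1 (F u.1)

/-- The composition `w(x, ∂F)`, as a formal power series in `x`. -/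
def evalJet {𝕜 : Type*} [RCLike 𝕜] {n r : ℕ} {m : Fin r → ℕ}
    (w : MvPowerSeries (JetVar n m) 𝕜) (F : FormalTuple 𝕜 n r) : MvPowerSeries (Fin n) 𝕜 :=
  subst (jet m F) w

/-- For `F` with `ord F_j > m_j` the jet extension of `F` takes the value `0` at `x = 0`, so that
the substitution defining `evalJet` is legitimate. -/
theorem hasSubst_jet {𝕜 : Type*} [RCLike 𝕜] {n r : ℕ} {m : Fin r → ℕ} {F : FormalTuple 𝕜 n r}
    (hF : F ∈ formalGT 𝕜 n m) : HasSubst (jet m F) := by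
  refine hasSubst_of_constantCoeff_zero fun v => ?_
  rcases v with i | ⟨j, α, hα⟩
  · simp [jet]
  · rw [← coeff_zero_eq_constantCoeff_apply]
    simp only [jet, coeff_iterPDeriv, zero_add]
    rw [coeff_of_lt_order, mul_zero]
    exact lt_of_le_of_lt (by exact_mod_cast hα) (hF j)

/-! ### Actions

The pseudo-group `𝓖 = id + 𝓕^{>0}` is parametrized by `F ∈ 𝓕^{>0}`; `act F X` stands for
`(id + F)_* X`. No property of the composition law of `𝓖` is used, so any family of
self-maps of the affine space is allowed; in particular a left or a right action, for any group
(or pseudo-group) law on `id + 𝓕^{>0}`. -/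

/-- The remainder `𝓣(R; F) = (id + F)_* X - X - 𝓢(F)`, where `X = P + R`. -/
def remainder {𝕜 : Type*} [RCLike 𝕜] {n r s q : ℕ} {m : Fin r → ℕ} {P : FormalTuple 𝕜 n s}
    (act : FGT 𝕜 n m 0 → AffineGerms q P → AffineGerms q P)
    (S : FGT 𝕜 n m 0 →ₗ[𝕜] analyticTuples 𝕜 n s)
    (X : AffineGerms q P) (F : FGT 𝕜 n m 0) : FormalTuple 𝕜 n s :=
  (act F X).1 - X.1 - (S F).1

/-- The action is filtering, with linear part `S` (which does not depend on `X`). -/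
structure IsFiltering {𝕜 : Type*} [RCLike 𝕜] {n r s q : ℕ} {m : Fin r → ℕ}
    {P : FormalTuple 𝕜 n s}
    (act : FGT 𝕜 n m 0 → AffineGerms q P → AffineGerms q P)
    (S : FGT 𝕜 n m 0 →ₗ[𝕜] analyticTuples 𝕜 n s) : Prop where
  /-- `𝓢(𝓕^{(i)}) ⊆ (𝔸_n^s)^{(q+i)}`. -/
  map_hom : ∀ (i : ℕ), 1 ≤ i → ∀ F : FGT 𝕜 n m 0, F.1 ∈ FHom 𝕜 n m i →
    (S F).1 ∈ AHom 𝕜 n s (q + i)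
  /-- `𝓢(𝓕^{>i}) ⊆ (𝔸_n^s)_{>q+i}`; with `map_hom` this says that `𝓢` acts degree by degree. -/
  map_gt : ∀ (i : ℕ) (F : FGT 𝕜 n m 0), F.1 ∈ FGT 𝕜 n m i → (S F).1 ∈ AGT 𝕜 n s (q + i)
  /-- `𝓣(R; 0) = 0`. -/
  remainder_zero : ∀ X : AffineGerms q P, remainder act S X 0 = 0
  /-- `ord (𝓣(R; F) - 𝓣(R; G)) > ord (F - G) + q`, the order of `F - G` being
  that of the filtration `𝓕^{>i}`: if it is `≥ i + 1` then the left hand side is `> q + i + 1`. -/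
  remainder_sub : ∀ (X : AffineGerms q P) (F G : FGT 𝕜 n m 0) (i : ℕ),
    F.1 - G.1 ∈ FGT 𝕜 n m i →
    remainder act S X F - remainder act S X G ∈ formalGT 𝕜 n fun _ : Fin s => q + (i + 1)

/-- At the point `X` the action is given by the germ at `0` of the analytic map `W` on the space of
`m`-jets: `W(x, 0) = 0` and `(id + F)_* X = X + 𝓢(F) + W(x, j_x^m F)`. -/
structure IsJetRepresentation {𝕜 : Type*} [RCLike 𝕜] {n r s q : ℕ} {m : Fin r → ℕ}
    {P : FormalTuple 𝕜 n s}
    (act : FGT 𝕜 n m 0 → AffineGerms q P → AffineGerms q P)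
    (S : FGT 𝕜 n m 0 →ₗ[𝕜] analyticTuples 𝕜 n s)
    (X : AffineGerms q P) (W : Fin s → MvPowerSeries (JetVar n m) 𝕜) : Prop where
  convergent : ∀ l, IsConvergent (W l)
  at_zero : ∀ l, evalJet (W l) (0 : FormalTuple 𝕜 n r) = 0
  act_eq : ∀ (F : FGT 𝕜 n m 0) (l : Fin s),
    (act F X).1 l = X.1 l + (S F).1 l + evalJet (W l) F.1

/-- Regularity of `W`: for every formal `F` with `ord F_j ≥ m_j + 1`,
`ord (∂W_l/∂u_{j,α})(x, ∂F) ≥ max (0, |α| + q + 1 - m_j)` (truncated subtraction). -/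
def IsRegularGerm {𝕜 : Type*} [RCLike 𝕜] {n r s : ℕ} {m : Fin r → ℕ} (q : ℕ)
    (W : Fin s → MvPowerSeries (JetVar n m) 𝕜) : Prop :=
  ∀ F ∈ formalGT 𝕜 n m, ∀ (l : Fin s) (u : JetCoord n m),
    ((u.2.1.degree + q + 1 - m u.1 : ℕ) : ℕ∞) ≤
      (evalJet (pderiv 𝕜 (Sum.inr u) (W l)) F).order

/-- The action is an analytic differential action of order `m`, and it is regular. -/
def IsRegularAnalyticDifferential {𝕜 : Type*} [RCLike 𝕜] {n r s q : ℕ} {m : Fin r → ℕ}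
    {P : FormalTuple 𝕜 n s}
    (act : FGT 𝕜 n m 0 → AffineGerms q P → AffineGerms q P)
    (S : FGT 𝕜 n m 0 →ₗ[𝕜] analyticTuples 𝕜 n s) : Prop :=
  ∀ X : AffineGerms q P, ∃ W : Fin s → MvPowerSeries (JetVar n m) 𝕜,
    IsJetRepresentation act S X W ∧ IsRegularGerm q W

/-- The restriction `𝓢^{(i)} : 𝓕^{(i)} → (𝔸_n^s)^{(q+i)}` of `𝓢`, for `i ≥ 1`. -/
def IsFiltering.gradedMap {𝕜 : Type*} [RCLike 𝕜] {n r s q : ℕ} {m : Fin r → ℕ}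
    {P : FormalTuple 𝕜 n s}
    {act : FGT 𝕜 n m 0 → AffineGerms q P → AffineGerms q P}
    {S : FGT 𝕜 n m 0 →ₗ[𝕜] analyticTuples 𝕜 n s}
    (h : IsFiltering act S) (i : ℕ) (hi : 1 ≤ i) :
    FHom 𝕜 n m i →ₗ[𝕜] AHom 𝕜 n s (q + i) :=
  LinearMap.codRestrict (AHom 𝕜 n s (q + i))
    ((analyticTuples 𝕜 n s).subtype ∘ₗ S ∘ₗ Submodule.inclusion (FHom_le_FGT 𝕜 n m hi))
    fun F => h.map_hom i hi _ F.2

/-! ### Normal forms -/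

/-- `N̂ = N^{(q+1)} ⊕ N^{(q+2)} ⊕ ⋯` (formal sums). The space `N i` stands for `N^{(q+i)}`, and only
the indices `i ≥ 1` matter. -/
def formalSum {𝕜 : Type*} [RCLike 𝕜] {n s q : ℕ}
    (N : ∀ i : ℕ, Submodule 𝕜 (AHom 𝕜 n s (q + i))) : Set (FormalTuple 𝕜 n s) :=
  {f | f ∈ formalGT 𝕜 n (fun _ : Fin s => q) ∧ ∀ i, 1 ≤ i → homPart (q + i) f ∈ N i}

/-- The formal normal form `P + N̂` holds in the analytic category. -/
def HoldsInAnalyticCategory {𝕜 : Type*} [RCLike 𝕜] {n r s q : ℕ} {m : Fin r → ℕ}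
    {P : FormalTuple 𝕜 n s}
    (act : FGT 𝕜 n m 0 → AffineGerms q P → AffineGerms q P)
    (N : ∀ i : ℕ, Submodule 𝕜 (AHom 𝕜 n s (q + i))) : Prop :=
  ∀ X : AffineGerms q P, ∃ F : FGT 𝕜 n m 0,
    (act F X).1 - P ∈ formalSum N ∩ (AGT 𝕜 n s q : Set (FormalTuple 𝕜 n s))

end AnalyticNormalForm

end

open AnalyticNormalForm

/-! The normal form equation is solved degree by degree. By the filtering property, the part of
degree `q + (k+1)` of the residual `R + 𝓣(R; F)` depends only on `F` modulo `𝓕^{>k}`. An increment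
in `𝓕^{(k+1)}` can therefore cancel the component of that part in the image of `𝓢`, and later
increments do not disturb it (`exists_approximations`, `homPart_act_mem`). What has to be proved is
convergence.

Sizes are measured by the weighted `ℓ¹`-norm `wnorm`, which is submultiplicative and behaves well
under substitution. Derivatives of order at most `m_j` of a form of degree `m_j + i` cost a factor
`O(i^{m_j})`, and the assumed division by `i^{m_j}` pays for exactly this. Hence the jets of a sum
of increments are controlled by `∑ t^i · gradedSize`, without loss
(`exists_wnorm_iterPDeriv_sum_le`).

Expand `W(x, ∂F)` at the polynomial `Φ q`. Regularity makes the linear term of size `t^{q+1} y`,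
where `y` bounds the jet of the increment, and the rest is `O(y²)` (`exists_wnorm_evalJet_sub_le`).
Let `g N` be the weighted size of the increments with indices from `q` up to `N - 1`. They are
governed by degrees at least `2q+1` of the residual, so `t^q g(N+1) ≤ D (t^{2q+1} + t^{q+1} c g(N) +
(c g(N))²)`. Under `g(N) ≤ η t^q` every term on the right has a factor `t^{2q}`. For small `η`, and
then small `t`, the bound reproduces itself (`exists_small_radius`). The increments thus grow at
most geometrically (`exists_gradedSize_le`), and their sum is an analytic solution (`exists_limit`).
-/

noncomputable section

namespace AnalyticNormalForm

open MvPowerSeries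
open scoped ENNReal MvPowerSeries.WithPiTopology

/-! ### Weighted `ℓ¹`-norms of power series -/

section WeightedNorm

variable {𝕜 : Type*} [RCLike 𝕜] {σ : Type*} [Fintype σ]

/-- The weighted `ℓ¹`-norm of a power series: the value at `ρ` of the series of the absolute values
of the coefficients. -/
def wnorm (ρ : σ → ℝ≥0∞) (f : MvPowerSeries σ 𝕜) : ℝ≥0∞ :=
  ∑' α : σ →₀ ℕ, ‖coeff α f‖ₑ * ∏ v, ρ v ^ α v

theorem wnorm_zero (ρ : σ → ℝ≥0∞) : wnorm ρ (0 : MvPowerSeries σ 𝕜) = 0 := by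
  simp [wnorm]

theorem wnorm_add_le (ρ : σ → ℝ≥0∞) (f g : MvPowerSeries σ 𝕜) :
    wnorm ρ (f + g) ≤ wnorm ρ f + wnorm ρ g := by
  unfold wnorm
  rw [← ENNReal.tsum_add]
  refine ENNReal.tsum_le_tsum fun α => ?_
  rw [← add_mul, map_add]
  gcongr
  exact enorm_add_le _ _

theorem wnorm_sum_le {ι : Type*} (s : Finset ι) (ρ : σ → ℝ≥0∞) (f : ι → MvPowerSeries σ 𝕜) :
    wnorm ρ (∑ i ∈ s, f i) ≤ ∑ i ∈ s, wnorm ρ (f i) := by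
  classical
  induction s using Finset.induction_on with
  | empty => simp [wnorm_zero]
  | insert a s ha ih =>
    rw [Finset.sum_insert ha, Finset.sum_insert ha]
    exact (wnorm_add_le _ _ _).trans (by gcongr)

theorem wnorm_smul (ρ : σ → ℝ≥0∞) (c : 𝕜) (f : MvPowerSeries σ 𝕜) :
    wnorm ρ (c • f) = ‖c‖ₑ * wnorm ρ f := by
  unfold wnorm
  rw [← ENNReal.tsum_mul_left]
  refine tsum_congr fun α => ?_
  rw [coeff_smul, enorm_mul, mul_assoc]

theorem wnorm_mono {ρ ρ' : σ → ℝ≥0∞} (h : ∀ v, ρ v ≤ ρ' v) (f : MvPowerSeries σ 𝕜) :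
    wnorm ρ f ≤ wnorm ρ' f := by
  refine ENNReal.tsum_le_tsum fun α => ?_
  gcongr with v
  exact h v

theorem wnorm_monomial (ρ : σ → ℝ≥0∞) (α : σ →₀ ℕ) (c : 𝕜) :
    wnorm ρ (monomial α c) = ‖c‖ₑ * ∏ v, ρ v ^ α v := by
  classical
  unfold wnorm
  rw [tsum_eq_single α]
  · simp
  · intro β hβ
    rw [coeff_monomial_ne hβ]; simp

theorem wnorm_one (ρ : σ → ℝ≥0∞) : wnorm ρ (1 : MvPowerSeries σ 𝕜) = 1 := by
  have := wnorm_monomial ρ 0 (1 : 𝕜)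
  simpa using this

theorem wnorm_X (ρ : σ → ℝ≥0∞) (i : σ) : wnorm ρ (X i : MvPowerSeries σ 𝕜) = ρ i := by
  classical
  have := wnorm_monomial ρ (Finsupp.single i 1) (1 : 𝕜)
  rw [Finset.prod_eq_single i] at this
  · simpa [X] using this
  · intro b _ hb; simp [hb.symm]
  · simp

theorem wnorm_mul_le (ρ : σ → ℝ≥0∞) (f g : MvPowerSeries σ 𝕜) :
    wnorm ρ (f * g) ≤ wnorm ρ f * wnorm ρ g := by
  classical
  let φ : (σ →₀ ℕ) → (MvPowerSeries σ 𝕜) → ℝ≥0∞ := fun α h => ‖coeff α h‖ₑ * ∏ v, ρ v ^ α v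
  calc wnorm ρ (f * g)
      ≤ ∑' α : σ →₀ ℕ, ∑ p ∈ Finset.HasAntidiagonal.antidiagonal α, φ p.1 f * φ p.2 g := by
        refine ENNReal.tsum_le_tsum fun α => ?_
        rw [coeff_mul]
        refine (mul_le_mul_left (enorm_sum_le _ _) _).trans (le_of_eq ?_)
        rw [Finset.sum_mul]
        refine Finset.sum_congr rfl fun p hp => ?_
        rw [Finset.HasAntidiagonal.mem_antidiagonal] at hp
        subst hp
        simp only [φ, Finsupp.add_apply, pow_add, Finset.prod_mul_distrib, enorm_mul]
        ring
    _ = ∑' x : (Σ α : σ →₀ ℕ, Finset.HasAntidiagonal.antidiagonal α),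
          φ x.2.1.1 f * φ x.2.1.2 g := by
        rw [ENNReal.tsum_sigma']
        refine tsum_congr fun α => ?_
        exact (Finset.tsum_subtype (Finset.HasAntidiagonal.antidiagonal α)
          fun p => φ p.1 f * φ p.2 g).symm
    _ = ∑' p : (σ →₀ ℕ) × (σ →₀ ℕ), φ p.1 f * φ p.2 g :=
        Finset.HasAntidiagonal.sigmaAntidiagonalEquivProd.tsum_eq (fun p => φ p.1 f * φ p.2 g)
    _ = wnorm ρ f * wnorm ρ g := by
        change _ = (∑' α, φ α f) * ∑' α, φ α g
        rw [ENNReal.tsum_prod', ← ENNReal.tsum_mul_right]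
        refine tsum_congr fun α => ?_
        exact ENNReal.tsum_mul_left (a := φ α f) (f := fun β => φ β g)

/-- Coefficientwise convergence suffices, because the sums in `ℝ≥0∞` may be interchanged freely.
This transfers monomial estimates to substitutions. -/
theorem wnorm_le_tsum {ι : Type*} (ρ : σ → ℝ≥0∞) {h : MvPowerSeries σ 𝕜}
    {g : ι → MvPowerSeries σ 𝕜} (hg : HasSum g h) :
    wnorm ρ h ≤ ∑' i, wnorm ρ (g i) := by
  unfold wnorm
  rw [ENNReal.tsum_comm]
  refine ENNReal.tsum_le_tsum fun α => ?_
  rw [ENNReal.tsum_mul_right]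
  gcongr
  rw [← ((WithPiTopology.hasSum_iff_hasSum_coeff.1 hg) α).tsum_eq]
  exact enorm_tsum_le_tsum_enorm

theorem prod_const_pow (t : ℝ≥0∞) (α : σ →₀ ℕ) : ∏ v, t ^ α v = t ^ α.degree := by
  rw [Finset.prod_pow_eq_pow_sum, Finsupp.degree_eq_sum]

theorem wnorm_const (t : ℝ≥0∞) (f : MvPowerSeries σ 𝕜) :
    wnorm (fun _ => t) f = ∑' α : σ →₀ ℕ, ‖coeff α f‖ₑ * t ^ α.degree :=
  tsum_congr fun α => by rw [prod_const_pow]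

/-- A series of order `≥ k` has norm `O(t ^ k)`. -/
theorem wnorm_mul_pow_le {t t₀ : ℝ≥0∞} (ht : t ≤ t₀) {k : ℕ} {f : MvPowerSeries σ 𝕜}
    (hf : (k : ℕ∞) ≤ f.order) :
    wnorm (fun _ => t) f * t₀ ^ k ≤ t ^ k * wnorm (fun _ => t₀) f := by
  rw [wnorm_const, wnorm_const, ← ENNReal.tsum_mul_right, ← ENNReal.tsum_mul_left]
  refine ENNReal.tsum_le_tsum fun α => ?_
  by_cases hα : k ≤ α.degree
  · obtain ⟨e, he⟩ := Nat.exists_eq_add_of_le hα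
    rw [he, pow_add, pow_add]
    have : t ^ e ≤ t₀ ^ e := by gcongr
    calc ‖coeff α f‖ₑ * (t ^ k * t ^ e) * t₀ ^ k
        ≤ ‖coeff α f‖ₑ * (t ^ k * t₀ ^ e) * t₀ ^ k := by gcongr
      _ = _ := by ring
  · rw [coeff_of_lt_order]
    · simp
    · exact lt_of_lt_of_le (by exact_mod_cast not_le.1 hα) hf

variable [DecidableEq σ]

theorem mem_univ_finsuppAntidiag {d : ℕ} {α : σ →₀ ℕ} :
    α ∈ (Finset.univ : Finset σ).finsuppAntidiag d ↔ α.degree = d := by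
  rw [Finset.mem_finsuppAntidiag, Finsupp.degree_eq_sum]
  simp

theorem ofReal_homNorm (d : ℕ) (f : MvPowerSeries σ 𝕜) :
    ENNReal.ofReal (homNorm d f) = ∑ α ∈ (Finset.univ : Finset σ).finsuppAntidiag d,
      ‖coeff α f‖ₑ := by
  unfold homNorm
  rw [ENNReal.ofReal_sum_of_nonneg fun _ _ => norm_nonneg _]
  exact Finset.sum_congr rfl fun α _ => ofReal_norm _

theorem wnorm_const_eq_tsum_homNorm (t : ℝ≥0∞) (f : MvPowerSeries σ 𝕜) :
    wnorm (fun _ => t) f = ∑' d : ℕ, t ^ d * ENNReal.ofReal (homNorm d f) := by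
  rw [wnorm_const]
  have h1 : ∀ α : σ →₀ ℕ, ‖coeff α f‖ₑ * t ^ α.degree =
      ∑' d : ℕ, if α.degree = d then t ^ d * ‖coeff α f‖ₑ else 0 := by
    intro α
    rw [tsum_eq_single α.degree]
    · rw [if_pos rfl, mul_comm]
    · intro d hd; rw [if_neg hd.symm]
  rw [tsum_congr h1, ENNReal.tsum_comm]
  refine tsum_congr fun d => ?_
  rw [ofReal_homNorm, Finset.mul_sum, tsum_eq_sum (s := (Finset.univ : Finset σ).finsuppAntidiag d)]
  · exact Finset.sum_congr rfl fun α hα => if_pos (mem_univ_finsuppAntidiag.1 hα)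
  · intro α hα
    rw [mem_univ_finsuppAntidiag] at hα
    exact if_neg hα

/-- The passage from `wnorm` estimates back to real inequalities between homogeneous parts. -/
theorem sum_homNorm_le_wnorm {t : ℝ} (ht : 0 ≤ t) (s : Finset ℕ) (f : MvPowerSeries σ 𝕜) :
    ENNReal.ofReal (∑ d ∈ s, t ^ d * homNorm d f) ≤ wnorm (fun _ => ENNReal.ofReal t) f := by
  rw [wnorm_const_eq_tsum_homNorm, ENNReal.ofReal_sum_of_nonneg
    fun d _ => mul_nonneg (pow_nonneg ht d) (homNorm_nonneg d f)]
  refine le_trans (le_of_eq (Finset.sum_congr rfl fun d _ => ?_)) (ENNReal.sum_le_tsum s)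
  rw [ENNReal.ofReal_mul (pow_nonneg ht d), ENNReal.ofReal_pow ht]

/-- A convergent series has finite norm for small weights. -/
theorem IsConvergent.exists_wnorm_ne_top {f : MvPowerSeries σ 𝕜} (hf : IsConvergent f) :
    ∃ t : ℝ, 0 < t ∧ wnorm (fun _ => ENNReal.ofReal t) f ≠ ∞ := by
  obtain ⟨M, ρ, hM, hρ, h⟩ := hf
  refine ⟨ρ / 2, by positivity, ?_⟩
  rw [wnorm_const_eq_tsum_homNorm]
  have hle : ∀ d : ℕ, ENNReal.ofReal (ρ / 2) ^ d * ENNReal.ofReal (homNorm d f) ≤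
      ENNReal.ofReal M * (2⁻¹) ^ d := by
    intro d
    have h2 : (2⁻¹ : ℝ≥0∞) = ENNReal.ofReal 2⁻¹ := by
      rw [ENNReal.ofReal_inv_of_pos two_pos]; simp
    rw [h2, ← ENNReal.ofReal_pow (by positivity), ← ENNReal.ofReal_pow (by positivity),
      ← ENNReal.ofReal_mul (by positivity), ← ENNReal.ofReal_mul hM.le]
    refine ENNReal.ofReal_le_ofReal ?_
    calc (ρ / 2) ^ d * homNorm d f ≤ (ρ / 2) ^ d * (M * (1 / ρ) ^ d) := by
          gcongr; exact h d
      _ = M * (ρ / 2 * (1 / ρ)) ^ d := by rw [mul_pow]; ring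
      _ = M * 2⁻¹ ^ d := by congr 2; field_simp
  refine ne_top_of_le_ne_top ?_ (ENNReal.tsum_le_tsum hle)
  rw [ENNReal.tsum_mul_left, ENNReal.tsum_geometric]
  exact ENNReal.mul_ne_top ENNReal.ofReal_ne_top (by simp)

/-- The part of degree `≥ k` of a series of finite norm has norm `O(t ^ k)`. -/
theorem sum_homNorm_le_of_wnorm_ne_top {f : MvPowerSeries σ 𝕜} {t₀ : ℝ} (ht₀ : 0 < t₀)
    (hf : wnorm (fun _ => ENNReal.ofReal t₀) f ≠ ∞) (k : ℕ) :
    ∃ K : ℝ, 0 ≤ K ∧ ∀ t : ℝ, 0 ≤ t → t ≤ t₀ → ∀ s : Finset ℕ, (∀ d ∈ s, k ≤ d) →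
      ∑ d ∈ s, t ^ d * homNorm d f ≤ K * t ^ k := by
  set Z := (wnorm (fun _ => ENNReal.ofReal t₀) f).toReal
  refine ⟨Z / t₀ ^ k, by positivity, fun t ht htt s hs => ?_⟩
  have hZ : ∑ d ∈ s, t₀ ^ d * homNorm d f ≤ Z :=
    (ENNReal.ofReal_le_iff_le_toReal hf).1 (sum_homNorm_le_wnorm ht₀.le s f)
  calc ∑ d ∈ s, t ^ d * homNorm d f
      ≤ ∑ d ∈ s, (t / t₀) ^ k * (t₀ ^ d * homNorm d f) := by
        refine Finset.sum_le_sum fun d hd => ?_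
        obtain ⟨e, rfl⟩ := Nat.exists_eq_add_of_le (hs d hd)
        rw [← mul_assoc]
        refine mul_le_mul_of_nonneg_right ?_ (homNorm_nonneg _ f)
        rw [div_pow, pow_add, pow_add, ← mul_assoc, div_mul_cancel₀ _ (by positivity)]
        gcongr
    _ = (t / t₀) ^ k * ∑ d ∈ s, t₀ ^ d * homNorm d f := by rw [Finset.mul_sum]
    _ ≤ (t / t₀) ^ k * Z := by gcongr
    _ = Z / t₀ ^ k * t ^ k := by rw [div_pow]; ring

end WeightedNorm

/-! ### Taylor and Cauchy estimates for substitution -/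

section Taylor

variable {𝕜 : Type*} [RCLike 𝕜] {σ τ : Type*} [Fintype σ]

/-- The linear part at `a`, in the direction `b`, of a polynomial with power series arguments. -/
def linPart (a b : σ → MvPowerSeries τ 𝕜) (p : MvPolynomial σ 𝕜) : MvPowerSeries τ 𝕜 :=
  ∑ v, MvPolynomial.aeval a (MvPolynomial.pderiv v p) * b v

/-- The Leibniz rule, used as the inductive step when monomials are built one variable at a time. -/
theorem linPart_mul_X (a b : σ → MvPowerSeries τ 𝕜) (p : MvPolynomial σ 𝕜) (w : σ) :
    linPart a b (p * MvPolynomial.X w) =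
      linPart a b p * a w + MvPolynomial.aeval a p * b w := by
  classical
  unfold linPart
  rw [Finset.sum_mul]
  have h : ∀ v, MvPolynomial.aeval a (MvPolynomial.pderiv v (p * MvPolynomial.X w)) * b v =
      MvPolynomial.aeval a (MvPolynomial.pderiv v p) * b v * a w +
        if v = w then MvPolynomial.aeval a p * b w else 0 := by
    intro v
    rw [MvPolynomial.pderiv_mul, map_add, map_mul, map_mul, MvPolynomial.aeval_X,
      MvPolynomial.pderiv_X]
    split_ifs with hv
    · subst hv; simp; ring
    · rw [Pi.single_eq_of_ne (Ne.symm hv)]; simp; ring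
  rw [Finset.sum_congr rfl fun v _ => h v, Finset.sum_add_distrib]
  simp

/-- Norm estimate for the second order Taylor remainder of a monomial. -/
theorem wnorm_monomial_taylor_le [Fintype τ] {a b : σ → MvPowerSeries τ 𝕜} {ρ : τ → ℝ≥0∞}
    {A B : σ → ℝ≥0∞} {ε : ℝ≥0∞} (hε : ε ≤ 1) (ha : ∀ v, wnorm ρ (a v) ≤ A v)
    (hb : ∀ v, wnorm ρ (b v) ≤ ε * B v) (α : σ →₀ ℕ) :
    wnorm ρ (MvPolynomial.aeval (a + b) (MvPolynomial.monomial α (1 : 𝕜)) -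
      MvPolynomial.aeval a (MvPolynomial.monomial α (1 : 𝕜)) -
      linPart a b (MvPolynomial.monomial α (1 : 𝕜))) ≤ ε ^ 2 * ∏ v, (A v + B v) ^ α v := by
  classical
  -- The induction on the number of factors needs all three pieces at once: `P₀`, `P₁`, `P₂`
  -- majorize the value, the linear part and the remainder, and together stay below the product of
  -- the `A v + B v`.
  suffices h : ∀ M : Multiset σ, ∃ P₀ P₁ P₂ : ℝ≥0∞,
      wnorm ρ (MvPolynomial.aeval a
        (MvPolynomial.monomial (Multiset.toFinsupp M) (1 : 𝕜))) ≤ P₀ ∧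
      wnorm ρ (linPart a b (MvPolynomial.monomial (Multiset.toFinsupp M) (1 : 𝕜))) ≤ ε * P₁ ∧
      wnorm ρ (MvPolynomial.aeval (a + b)
          (MvPolynomial.monomial (Multiset.toFinsupp M) (1 : 𝕜)) -
        MvPolynomial.aeval a (MvPolynomial.monomial (Multiset.toFinsupp M) (1 : 𝕜)) -
        linPart a b (MvPolynomial.monomial (Multiset.toFinsupp M) (1 : 𝕜))) ≤ ε ^ 2 * P₂ ∧
      P₀ + P₁ + P₂ ≤ ∏ v, (A v + B v) ^ (Multiset.toFinsupp M) v by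
    obtain ⟨P₀, P₁, P₂, -, -, h2, h3⟩ := h (Finsupp.toMultiset α)
    rw [Finsupp.toMultiset_toFinsupp] at h2 h3
    refine h2.trans ?_
    gcongr
    exact le_add_self.trans h3
  intro M
  induction M using Multiset.induction_on with
  | empty =>
    refine ⟨1, 0, 0, ?_, ?_, ?_, by simp⟩ <;>
    simp [linPart, wnorm_zero, wnorm_one]
  | cons w M ih =>
    obtain ⟨P₀, P₁, P₂, h0, h1, h2, h3⟩ := ih
    have hmon : MvPolynomial.monomial (Multiset.toFinsupp (w ::ₘ M)) (1 : 𝕜) =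
        MvPolynomial.monomial (Multiset.toFinsupp M) 1 * MvPolynomial.X w := by
      rw [← Multiset.singleton_add, map_add, Multiset.toFinsupp_singleton, add_comm,
        MvPolynomial.X, MvPolynomial.monomial_mul, one_mul]
    rw [hmon, linPart_mul_X]
    simp only [map_mul, MvPolynomial.aeval_X, Pi.add_apply]
    set p := MvPolynomial.aeval (a + b) (MvPolynomial.monomial (Multiset.toFinsupp M) (1 : 𝕜))
    set p₀ := MvPolynomial.aeval a (MvPolynomial.monomial (Multiset.toFinsupp M) (1 : 𝕜))
    set p₁ := linPart a b (MvPolynomial.monomial (Multiset.toFinsupp M) (1 : 𝕜))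
    refine ⟨P₀ * A w, P₁ * A w + P₀ * B w, P₂ * A w + P₂ * B w + P₁ * B w, ?_, ?_, ?_, ?_⟩
    · exact (wnorm_mul_le _ _ _).trans (mul_le_mul' h0 (ha w))
    · calc wnorm ρ (p₁ * a w + p₀ * b w)
          ≤ ε * P₁ * A w + P₀ * (ε * B w) := (wnorm_add_le _ _ _).trans (add_le_add
            ((wnorm_mul_le _ _ _).trans (mul_le_mul' h1 (ha w)))
            ((wnorm_mul_le _ _ _).trans (mul_le_mul' h0 (hb w))))
        _ = _ := by ring
    -- The remainder of the product consists of the old remainder times either summand and the old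
    -- linear part times `b w`. Only the middle term carries `ε³`; there `ε ≤ 1` is used.
    · have hid : p * (a w + b w) - p₀ * a w - (p₁ * a w + p₀ * b w) =
          (p - p₀ - p₁) * a w + (p - p₀ - p₁) * b w + p₁ * b w := by ring
      rw [hid]
      calc wnorm ρ ((p - p₀ - p₁) * a w + (p - p₀ - p₁) * b w + p₁ * b w)
          ≤ ε ^ 2 * P₂ * A w + ε ^ 2 * P₂ * (ε * B w) + ε * P₁ * (ε * B w) :=
            (wnorm_add_le _ _ _).trans (add_le_add ((wnorm_add_le _ _ _).trans (add_le_add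
              ((wnorm_mul_le _ _ _).trans (mul_le_mul' h2 (ha w)))
              ((wnorm_mul_le _ _ _).trans (mul_le_mul' h2 (hb w)))))
              ((wnorm_mul_le _ _ _).trans (mul_le_mul' h1 (hb w))))
        _ ≤ ε ^ 2 * P₂ * A w + ε ^ 2 * P₂ * (1 * B w) + ε * P₁ * (ε * B w) := by gcongr
        _ = _ := by ring
    · have hprod : ∏ v, (A v + B v) ^ (Multiset.toFinsupp (w ::ₘ M)) v =
          (∏ v, (A v + B v) ^ (Multiset.toFinsupp M) v) * (A w + B w) := by
        rw [← Multiset.singleton_add, map_add, Multiset.toFinsupp_singleton]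
        simp only [Finsupp.add_apply, pow_add, Finset.prod_mul_distrib]
        rw [mul_comm]
        congr 1
        rw [Finset.prod_eq_single w]
        · simp
        · intro v _ hv; simp [hv.symm]
        · simp
      rw [hprod]
      calc P₀ * A w + (P₁ * A w + P₀ * B w) + (P₂ * A w + P₂ * B w + P₁ * B w)
          = (P₀ + P₁ + P₂) * (A w + B w) := by ring
        _ ≤ _ := by gcongr

theorem aeval_monomial_eq_prod (a : σ → MvPowerSeries τ 𝕜) (α : σ →₀ ℕ) (c : 𝕜) :
    MvPolynomial.aeval a (MvPolynomial.monomial α c) = c • ∏ v, a v ^ α v := by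
  rw [MvPolynomial.aeval_monomial, Finsupp.prod_fintype _ _ (by simp), Algebra.smul_def]

theorem hasSum_subst {a : σ → MvPowerSeries τ 𝕜} (ha : HasSubst a) (w : MvPowerSeries σ 𝕜) :
    HasSum (fun α => MvPolynomial.aeval a (MvPolynomial.monomial α (coeff α w))) (subst a w) := by
  rw [WithPiTopology.hasSum_iff_hasSum_coeff]
  intro e
  have hfin := coeff_subst_finite ha w e
  have heq : ∀ α : σ →₀ ℕ,
      coeff e (MvPolynomial.aeval a (MvPolynomial.monomial α (coeff α w))) =
      coeff α w • coeff e (α.prod fun s k => a s ^ k) := by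
    intro α
    rw [MvPolynomial.aeval_monomial, ← Algebra.smul_def, coeff_smul]; rfl
  simp only [heq]
  rw [coeff_subst ha, finsum_eq_sum_of_support_subset (s := hfin.toFinset) _ (by simp)]
  refine hasSum_sum_of_ne_finset_zero fun α hα => ?_
  by_contra h
  exact hα ((Set.Finite.mem_toFinset hfin).2 h)

/-- Reindexing by `α ↦ α + e_v`: the monomials outside its range do not contain the variable `v`,
and their derivative vanishes. -/
theorem hasSum_subst_pderiv [DecidableEq σ] {a : σ → MvPowerSeries τ 𝕜} (ha : HasSubst a)
    (w : MvPowerSeries σ 𝕜) (v : σ) :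
    HasSum (fun α => MvPolynomial.aeval a (MvPolynomial.pderiv v
      (MvPolynomial.monomial α (coeff α w)))) (subst a (pderiv 𝕜 v w)) := by
  have hinj : Function.Injective fun α : σ →₀ ℕ => α + Finsupp.single v 1 :=
    fun α β h => add_right_cancel h
  rw [← hinj.hasSum_iff]
  · convert! hasSum_subst ha (pderiv 𝕜 v w) using 2 with α
    simp [MvPolynomial.pderiv_monomial, coeff_pderiv]
  · intro α hα
    have hv : α v = 0 := by
      by_contra hv
      refine hα ⟨α - Finsupp.single v 1, ?_⟩
      exact tsub_add_cancel_of_le (Finsupp.single_le_iff.2 (Nat.one_le_iff_ne_zero.2 hv))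
    simp [MvPolynomial.pderiv_monomial, hv]

/-- Second order Taylor estimate for the substitution of power series in a power series. -/
theorem wnorm_subst_add_sub_le [Fintype τ] [DecidableEq σ] {a b : σ → MvPowerSeries τ 𝕜}
    (ha : HasSubst a) (hab : HasSubst (a + b)) {ρ : τ → ℝ≥0∞}
    {A B : σ → ℝ≥0∞} {ε : ℝ≥0∞} (hε : ε ≤ 1) (hA : ∀ v, wnorm ρ (a v) ≤ A v)
    (hB : ∀ v, wnorm ρ (b v) ≤ ε * B v) (w : MvPowerSeries σ 𝕜) :
    wnorm ρ (subst (a + b) w - subst a w - ∑ v, subst a (pderiv 𝕜 v w) * b v) ≤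
      ε ^ 2 * wnorm (A + B) w := by
  have hsum := ((hasSum_subst hab w).sub (hasSum_subst ha w)).sub
    (hasSum_sum (s := Finset.univ) fun v _ => (hasSum_subst_pderiv ha w v).mul_right (b v))
  refine (wnorm_le_tsum ρ hsum).trans ?_
  rw [wnorm.eq_def (A + B) w, ← ENNReal.tsum_mul_left]
  refine ENNReal.tsum_le_tsum fun α => ?_
  have hmon : MvPolynomial.monomial α (coeff α w) =
      coeff α w • MvPolynomial.monomial α (1 : 𝕜) := by
    rw [MvPolynomial.smul_monomial, smul_eq_mul, mul_one]
  have hsmul : MvPolynomial.aeval (a + b) (MvPolynomial.monomial α (coeff α w)) -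
      MvPolynomial.aeval a (MvPolynomial.monomial α (coeff α w)) -
      ∑ v, MvPolynomial.aeval a (MvPolynomial.pderiv v
        (MvPolynomial.monomial α (coeff α w))) * b v =
      coeff α w • (MvPolynomial.aeval (a + b) (MvPolynomial.monomial α (1 : 𝕜)) -
        MvPolynomial.aeval a (MvPolynomial.monomial α (1 : 𝕜)) -
        linPart a b (MvPolynomial.monomial α (1 : 𝕜))) := by
    simp only [hmon, linPart, map_smul, smul_sub, Finset.smul_sum,
      Derivation.map_smul, smul_mul_assoc]
  rw [hsmul, wnorm_smul]
  calc _ ≤ ‖coeff α w‖ₑ * (ε ^ 2 * ∏ v, (A v + B v) ^ α v) := by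
        gcongr; exact wnorm_monomial_taylor_le hε hA hB α
    _ = _ := by simp only [Pi.add_apply]; ring

theorem wnorm_pow_le [Fintype τ] (ρ : τ → ℝ≥0∞) (f : MvPowerSeries τ 𝕜) (k : ℕ) :
    wnorm ρ (f ^ k) ≤ wnorm ρ f ^ k := by
  induction k with
  | zero => simp [wnorm_one]
  | succ k ih =>
    rw [pow_succ, pow_succ]
    exact (wnorm_mul_le _ _ _).trans (by gcongr)

theorem wnorm_prod_le [Fintype τ] {ι : Type*} (s : Finset ι) (ρ : τ → ℝ≥0∞)
    (f : ι → MvPowerSeries τ 𝕜) : wnorm ρ (∏ i ∈ s, f i) ≤ ∏ i ∈ s, wnorm ρ (f i) := by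
  classical
  induction s using Finset.induction_on with
  | empty => simp [wnorm_one]
  | insert a s ha ih =>
    rw [Finset.prod_insert ha, Finset.prod_insert ha]
    exact (wnorm_mul_le _ _ _).trans (by gcongr)

theorem wnorm_subst_le [Fintype τ] {a : σ → MvPowerSeries τ 𝕜} (ha : HasSubst a) {ρ : τ → ℝ≥0∞}
    {A : σ → ℝ≥0∞} (hA : ∀ v, wnorm ρ (a v) ≤ A v) (w : MvPowerSeries σ 𝕜) :
    wnorm ρ (subst a w) ≤ wnorm A w := by
  refine (wnorm_le_tsum ρ (hasSum_subst ha w)).trans (ENNReal.tsum_le_tsum fun α => ?_)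
  rw [aeval_monomial_eq_prod, wnorm_smul]
  gcongr
  refine (wnorm_prod_le _ _ _).trans ?_
  gcongr with v
  exact (wnorm_pow_le _ _ _).trans (by gcongr; exact hA v)

/-- A Cauchy estimate: the first two terms of the binomial expansion give `(k+1) r^k ε ≤
(r+ε)^{k+1}`. -/
theorem wnorm_pderiv_mul_le [DecidableEq σ] (r ε : ℝ≥0∞) (f : MvPowerSeries σ 𝕜) (v : σ) :
    wnorm (fun _ => r) (pderiv 𝕜 v f) * ε ≤ wnorm (fun _ => r + ε) f := by
  have hinj : Function.Injective fun α : σ →₀ ℕ => α + Finsupp.single v 1 :=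
    fun α β h => add_right_cancel h
  rw [wnorm_const, wnorm_const, ← ENNReal.tsum_mul_right]
  refine le_trans (ENNReal.tsum_le_tsum fun α => ?_) (ENNReal.tsum_comp_le_tsum_of_injective hinj _)
  have hkey : ∀ k : ℕ, ((k + 1 : ℕ) : ℝ≥0∞) * r ^ k * ε + r ^ (k + 1) ≤ (r + ε) ^ (k + 1) := by
    intro k
    induction k with
    | zero => simp [add_comm]
    | succ k ih =>
      calc ((k + 1 + 1 : ℕ) : ℝ≥0∞) * r ^ (k + 1) * ε + r ^ (k + 1 + 1)
          = ((k + 1 : ℕ) * r ^ k * ε + r ^ (k + 1)) * r + r ^ (k + 1) * ε := by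
            push_cast; ring
        _ ≤ (r + ε) ^ (k + 1) * r + (r + ε) ^ (k + 1) * ε := by
            gcongr; exact le_self_add
        _ = _ := by ring
  rw [coeff_pderiv]
  have hdeg : (α + Finsupp.single v 1).degree = α.degree + 1 := by simp
  have hα : α v ≤ α.degree := Finsupp.le_degree v α
  have hn : ‖((α v : 𝕜) + 1)‖ₑ ≤ ((α.degree + 1 : ℕ) : ℝ≥0∞) := by
    have : ((α v : 𝕜) + 1) = ((α v + 1 : ℕ) : 𝕜) := by push_cast; rfl
    rw [this, ← ofReal_norm, RCLike.norm_natCast, ENNReal.ofReal_natCast]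
    exact_mod_cast Nat.succ_le_succ hα
  simp only [hdeg]
  calc ‖coeff (α + Finsupp.single v 1) f * ((α v : 𝕜) + 1)‖ₑ * r ^ α.degree * ε
      ≤ ‖coeff (α + Finsupp.single v 1) f‖ₑ *
        (((α.degree + 1 : ℕ) : ℝ≥0∞) * r ^ α.degree * ε) := by
        rw [enorm_mul, mul_assoc, mul_assoc, mul_assoc]
        gcongr
    _ ≤ _ := by
        gcongr
        exact le_self_add.trans (hkey _)

end Taylor

/-! ### Norms of jets and the variation of `W(x, ∂F)` -/

section Jets

variable {𝕜 : Type*} [RCLike 𝕜] {n r : ℕ} {m : Fin r → ℕ}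

theorem iterPDeriv_add (α : Fin n →₀ ℕ) (f g : MvPowerSeries (Fin n) 𝕜) :
    iterPDeriv α (f + g) = iterPDeriv α f + iterPDeriv α g := by
  ext β
  simp only [coeff_iterPDeriv, map_add, mul_add]

theorem iterPDeriv_sum {ι : Type*} (s : Finset ι) (α : Fin n →₀ ℕ)
    (f : ι → MvPowerSeries (Fin n) 𝕜) :
    iterPDeriv α (∑ i ∈ s, f i) = ∑ i ∈ s, iterPDeriv α (f i) := by
  ext β
  simp only [coeff_iterPDeriv, map_sum, Finset.mul_sum]

theorem homNorm_eq_zero_of_isHomogeneous {f : MvPowerSeries (Fin n) 𝕜} {p d : ℕ}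
    (hf : f.IsHomogeneous p) (hd : d ≠ p) : homNorm d f = 0 :=
  Finset.sum_eq_zero fun α hα => by
    rw [hf.coeff_eq_zero (by rw [degree_of_mem_antidiag hα]; exact hd), norm_zero]

theorem wnorm_one_of_isHomogeneous {f : MvPowerSeries (Fin n) 𝕜} {p : ℕ}
    (hf : f.IsHomogeneous p) : wnorm (fun _ => 1) f = ENNReal.ofReal (homNorm p f) := by
  rw [wnorm_const_eq_tsum_homNorm, tsum_eq_single p]
  · simp
  · intro d hd
    rw [homNorm_eq_zero_of_isHomogeneous hf hd]; simp

/-- The derivatives of order `≤ μ` of a form of degree `μ + i` are `O(i ^ μ)`. -/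
theorem wnorm_iterPDeriv_le {f : MvPowerSeries (Fin n) 𝕜} {μ i : ℕ} (hi : 1 ≤ i)
    (hf : f.IsHomogeneous (μ + i)) {α : Fin n →₀ ℕ} (hα : α.degree ≤ μ) {t : ℝ} (ht : 0 ≤ t) :
    wnorm (fun _ => ENNReal.ofReal t) (iterPDeriv α f) ≤
      ENNReal.ofReal ((μ + 1) ^ μ * t ^ (μ - α.degree) *
        (t ^ i * ((i : ℝ) ^ μ * homNorm (μ + i) f))) := by
  have h0 := homNorm_nonneg (μ + i) f
  have hc : 0 ≤ ((μ : ℝ) + 1) ^ μ * (i : ℝ) ^ μ * t ^ (μ + i - α.degree) := by positivity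
  have hrhs : ((μ : ℝ) + 1) ^ μ * t ^ (μ - α.degree) * (t ^ i * ((i : ℝ) ^ μ *
      homNorm (μ + i) f)) =
      ((μ : ℝ) + 1) ^ μ * (i : ℝ) ^ μ * t ^ (μ + i - α.degree) * homNorm (μ + i) f := by
    have : μ + i - α.degree = μ - α.degree + i := by omega
    rw [this, pow_add]; ring
  rw [hrhs, ENNReal.ofReal_mul hc, ← wnorm_one_of_isHomogeneous hf, wnorm_const, wnorm_const,
    ← ENNReal.tsum_mul_left]
  have hinj : Function.Injective fun β : Fin n →₀ ℕ => β + α := fun β γ h => add_right_cancel h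
  refine le_trans (ENNReal.tsum_le_tsum fun β => ?_)
    (ENNReal.tsum_comp_le_tsum_of_injective hinj _)
  simp only [one_pow, mul_one]
  by_cases hβ : (β + α).degree = μ + i
  · have hdeg : β.degree = μ + i - α.degree := by
      rw [map_add] at hβ; omega
    -- Differentiation produces at most `μ` factors, each at most `μ + i ≤ (μ + 1) i` since `i ≥ 1`.
    have hnat : (∏ l, (β l + α l).descFactorial (α l)) ≤ (μ + 1) ^ μ * i ^ μ := by
      calc (∏ l, (β l + α l).descFactorial (α l)) ≤ ∏ l, (μ + i) ^ α l := by
            refine Finset.prod_le_prod' fun l _ => (Nat.descFactorial_le_pow _ _).trans ?_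
            have := Finsupp.le_degree l (β + α)
            rw [Finsupp.add_apply, hβ] at this
            gcongr
        _ = (μ + i) ^ α.degree := by rw [Finset.prod_pow_eq_pow_sum, Finsupp.degree_eq_sum]
        _ ≤ (μ + i) ^ μ := Nat.pow_le_pow_right (by omega) hα
        _ ≤ ((μ + 1) * i) ^ μ := by gcongr; nlinarith
        _ = _ := mul_pow _ _ _
    have hnorm : ‖(∏ l, ((β l + α l).descFactorial (α l) : 𝕜))‖ₑ ≤
        ENNReal.ofReal (((μ : ℝ) + 1) ^ μ * (i : ℝ) ^ μ) := by
      rw [← ofReal_norm, ← Nat.cast_prod, RCLike.norm_natCast]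
      refine ENNReal.ofReal_le_ofReal ?_
      exact_mod_cast hnat
    rw [coeff_iterPDeriv, enorm_mul, hdeg, ENNReal.ofReal_mul (by positivity),
      ENNReal.ofReal_pow ht]
    calc _ ≤ ENNReal.ofReal (((μ : ℝ) + 1) ^ μ * (i : ℝ) ^ μ) * ‖coeff (β + α) f‖ₑ *
          ENNReal.ofReal t ^ (μ + i - α.degree) := by gcongr
      _ = _ := by ring
  · rw [coeff_iterPDeriv, hf.coeff_eq_zero hβ]; simp

/-- The increment of the jet extension. -/
def jetIncr (m : Fin r → ℕ) (G : FormalTuple 𝕜 n r) : JetVar n m → MvPowerSeries (Fin n) 𝕜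
  | Sum.inl _ => 0
  | Sum.inr u => iterPDeriv u.2.1 (G u.1)

theorem jet_add (F G : FormalTuple 𝕜 n r) : jet m (F + G) = jet m F + jetIncr m G := by
  funext v
  rcases v with i | u
  · simp [jet, jetIncr]
  · exact iterPDeriv_add _ _ _

theorem jet_one_le_order {F : FormalTuple 𝕜 n r} (hF : F ∈ formalGT 𝕜 n m) (v : JetVar n m) :
    ((1 : ℕ) : ℕ∞) ≤ (jet m F v).order := by
  refine nat_le_order fun β hβ => ?_
  have hβ0 : β = 0 := by rw [Nat.lt_one_iff, Finsupp.degree_eq_zero_iff] at hβ; exact hβ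
  subst hβ0
  rcases v with i | ⟨j, α, hα⟩
  · simp [jet]
  · simp only [jet, coeff_iterPDeriv, zero_add]
    rw [coeff_of_lt_order, mul_zero]
    exact lt_of_le_of_lt (by exact_mod_cast hα) (hF j)

/-- The variation of a regular analytic differential expression `w(x, ∂F)` when `F` is changed by
`G`: the linear part gains `q + 1` orders, the rest is quadratic. -/
theorem exists_wnorm_evalJet_sub_le {q : ℕ} {w : MvPowerSeries (JetVar n m) 𝕜}
    (hw : IsConvergent w) {F : FormalTuple 𝕜 n r} (hF : F ∈ formalGT 𝕜 n m)
    (hfin : ∀ v, wnorm (fun _ => 1) (jet m F v) ≠ ∞)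
    (hreg : ∀ u : JetCoord n m, ((u.2.1.degree + q + 1 - m u.1 : ℕ) : ℕ∞) ≤
      (evalJet (pderiv 𝕜 (Sum.inr u) w) F).order) :
    ∃ c t₀ b : ℝ, 0 < c ∧ 0 < t₀ ∧ t₀ ≤ 1 ∧ 0 < b ∧
      wnorm (fun _ => ENNReal.ofReal t₀) (evalJet w F) ≠ ∞ ∧
      ∀ t y : ℝ, 0 < t → t ≤ t₀ → 0 ≤ y → y ≤ b → ∀ G ∈ formalGT 𝕜 n m,
        (∀ u : JetCoord n m, wnorm (fun _ => ENNReal.ofReal t) (iterPDeriv u.2.1 (G u.1)) ≤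
          ENNReal.ofReal (t ^ (m u.1 - u.2.1.degree) * y)) →
        wnorm (fun _ => ENNReal.ofReal t) (evalJet w (F + G) - evalJet w F) ≤
          ENNReal.ofReal (c * (t ^ (q + 1) * y + y ^ 2)) := by
  obtain ⟨ρ, hρ, hρw⟩ := hw.exists_wnorm_ne_top
  -- Half of the radius goes to the jet of `F`. The other half serves both for the increment in the
  -- Taylor estimate and for the Cauchy estimate of the derivatives of `w`.
  set b : ℝ := ρ / 2 with hb
  have hb0 : 0 < b := by positivity
  have hρb : ENNReal.ofReal b + ENNReal.ofReal b = ENNReal.ofReal ρ := by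
    rw [← ENNReal.ofReal_add hb0.le hb0.le]; congr 1; rw [hb]; ring
  -- a radius for which all jet coordinates of `F` have norm at most `b`
  obtain ⟨t₀, ht₀, ht₀1, hjet⟩ : ∃ t₀ : ℝ, 0 < t₀ ∧ t₀ ≤ 1 ∧ ∀ t : ℝ, 0 ≤ t → t ≤ t₀ → ∀ v,
      wnorm (fun _ => ENNReal.ofReal t) (jet m F v) ≤ ENNReal.ofReal b := by
    set Z : ℝ := ∑ v, (wnorm (fun _ => 1) (jet m F v)).toReal with hZ
    have hZ0 : 0 ≤ Z := Finset.sum_nonneg fun _ _ => ENNReal.toReal_nonneg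
    refine ⟨min 1 (b / (Z + 1)), by positivity, min_le_left _ _, fun t ht htt v => ?_⟩
    have h1 : t ≤ 1 := htt.trans (min_le_left _ _)
    have h2 : t ≤ b / (Z + 1) := htt.trans (min_le_right _ _)
    have h3 := wnorm_mul_pow_le (t := ENNReal.ofReal t) (t₀ := 1)
      (by rw [← ENNReal.ofReal_one]; exact ENNReal.ofReal_le_ofReal h1) (jet_one_le_order hF v)
    rw [one_pow, mul_one, pow_one] at h3
    refine h3.trans ?_
    rw [← ENNReal.ofReal_toReal (hfin v), ← ENNReal.ofReal_mul ht]
    refine ENNReal.ofReal_le_ofReal ?_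
    have h4 : (wnorm (fun _ => 1) (jet m F v)).toReal ≤ Z :=
      Finset.single_le_sum (f := fun v => (wnorm (fun _ => 1) (jet m F v)).toReal)
        (fun _ _ => ENNReal.toReal_nonneg) (Finset.mem_univ v)
    rw [le_div_iff₀ (by positivity)] at h2
    nlinarith
  have hsubst := hasSubst_jet hF
  have hle : wnorm (fun _ => ENNReal.ofReal b) w ≤ wnorm (fun _ => ENNReal.ofReal ρ) w :=
    wnorm_mono (fun _ => by rw [← hρb]; exact le_self_add) w
  -- the norms of the linear coefficients
  have hpd : ∀ u : JetCoord n m, wnorm (fun _ => ENNReal.ofReal t₀)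
      (evalJet (pderiv 𝕜 (Sum.inr u) w) F) ≠ ∞ := by
    intro u
    refine ne_top_of_le_ne_top ?_ (wnorm_subst_le hsubst (hjet t₀ ht₀.le le_rfl) _)
    intro htop
    have h1 := wnorm_pderiv_mul_le (ENNReal.ofReal b) (ENNReal.ofReal b) w (Sum.inr u)
    rw [htop, hρb, ENNReal.top_mul (by simpa using hb0)] at h1
    exact hρw (top_le_iff.1 h1)
  set k : JetCoord n m → ℕ := fun u => u.2.1.degree + q + 1 - m u.1 with hk
  set K : JetCoord n m → ℝ := fun u => (wnorm (fun _ => ENNReal.ofReal t₀)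
    (evalJet (pderiv 𝕜 (Sum.inr u) w) F)).toReal / t₀ ^ k u with hK
  have hK0 : ∀ u, 0 ≤ K u := fun u => by positivity
  have hlin : ∀ t : ℝ, 0 < t → t ≤ t₀ → ∀ u : JetCoord n m, wnorm (fun _ => ENNReal.ofReal t)
      (evalJet (pderiv 𝕜 (Sum.inr u) w) F) ≤ ENNReal.ofReal (K u * t ^ k u) := by
    intro t ht htt u
    have h1 := wnorm_mul_pow_le (ENNReal.ofReal_le_ofReal htt) (hreg u)
    rw [← ENNReal.ofReal_toReal (hpd u), ← ENNReal.ofReal_pow ht₀.le,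
      ← ENNReal.ofReal_pow ht.le, ← ENNReal.ofReal_mul (by positivity)] at h1
    rw [← ENNReal.le_div_iff_mul_le (Or.inl (by simpa using pow_pos ht₀ _))
      (Or.inl ENNReal.ofReal_ne_top), ← ENNReal.ofReal_div_of_pos (by positivity)] at h1
    refine h1.trans (le_of_eq ?_)
    congr 1
    simp only [hK, hk]; ring
  set Z := (wnorm (fun _ => ENNReal.ofReal ρ) w).toReal with hZ
  have hZ0 : 0 ≤ Z := ENNReal.toReal_nonneg
  have hKs : 0 ≤ ∑ u, K u := Finset.sum_nonneg fun u _ => hK0 u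
  refine ⟨∑ u, K u + Z / b ^ 2 + 1, t₀, b, by positivity, ht₀, ht₀1, hb0,
    ne_top_of_le_ne_top (ne_top_of_le_ne_top hρw hle)
      (wnorm_subst_le hsubst (hjet t₀ ht₀.le le_rfl) _), ?_⟩
  intro t y ht htt hy hyb G hG hGu
  have ht1 : t ≤ 1 := htt.trans ht₀1
  have hsubst' := hasSubst_jet (m := m) (add_mem hF hG)
  rw [jet_add] at hsubst'
  -- The Taylor estimate is applied with `A = B = b` and `ε = y / b`, so its remainder is `O(y²)`.
  have hε : ENNReal.ofReal (y / b) ≤ 1 := by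
    rw [← ENNReal.ofReal_one]
    exact ENNReal.ofReal_le_ofReal ((div_le_one hb0).2 hyb)
  have hincr : ∀ v, wnorm (fun _ => ENNReal.ofReal t) (jetIncr m G v) ≤
      ENNReal.ofReal (y / b) * ENNReal.ofReal b := by
    intro v
    rw [← ENNReal.ofReal_mul (by positivity), div_mul_cancel₀ _ hb0.ne']
    rcases v with i | u
    · simp [jetIncr, wnorm_zero]
    · refine (hGu u).trans (ENNReal.ofReal_le_ofReal ?_)
      exact mul_le_of_le_one_left hy (pow_le_one₀ ht.le ht1)
  have hquad := wnorm_subst_add_sub_le hsubst hsubst' hε (hjet t ht.le htt) hincr w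
  have hlinsum : wnorm (fun _ => ENNReal.ofReal t)
      (∑ v, subst (jet m F) (pderiv 𝕜 v w) * jetIncr m G v) ≤
      ENNReal.ofReal ((∑ u, K u) * (t ^ (q + 1) * y)) := by
    rw [Fintype.sum_sum_type]
    have h0 : ∑ i : Fin n, subst (jet m F) (pderiv 𝕜 (Sum.inl i) w) *
        jetIncr m G (Sum.inl i) = 0 := by simp [jetIncr]
    rw [h0, zero_add, Finset.sum_mul, ENNReal.ofReal_sum_of_nonneg
      fun u _ => mul_nonneg (hK0 u) (by positivity)]
    refine (wnorm_sum_le _ _ _).trans (Finset.sum_le_sum fun u _ => ?_)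
    refine (wnorm_mul_le _ _ _).trans ((mul_le_mul' (hlin t ht htt u) (hGu u)).trans ?_)
    rw [← ENNReal.ofReal_mul (mul_nonneg (hK0 u) (by positivity))]
    refine ENNReal.ofReal_le_ofReal ?_
    -- The order of the coefficient and the weight of the derivative add up to at least `q + 1`,
    -- also when the subtraction in `k u` truncates.
    have h1 : t ^ (k u + (m u.1 - u.2.1.degree)) ≤ t ^ (q + 1) :=
      pow_le_pow_of_le_one ht.le ht1 (by simp only [hk]; omega)
    calc K u * t ^ k u * (t ^ (m u.1 - u.2.1.degree) * y)
        = K u * (t ^ (k u + (m u.1 - u.2.1.degree)) * y) := by rw [pow_add]; ring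
      _ ≤ _ := by gcongr
  have hid : evalJet w (F + G) - evalJet w F =
      (subst (jet m F + jetIncr m G) w - subst (jet m F) w -
        ∑ v, subst (jet m F) (pderiv 𝕜 v w) * jetIncr m G v) +
      ∑ v, subst (jet m F) (pderiv 𝕜 v w) * jetIncr m G v := by
    unfold evalJet; rw [jet_add]; ring
  rw [hid]
  refine (wnorm_add_le _ _ _).trans ((add_le_add hquad hlinsum).trans ?_)
  have hfun : ((fun _ => ENNReal.ofReal b) + fun _ => ENNReal.ofReal b : JetVar n m → ℝ≥0∞) =
      fun _ => ENNReal.ofReal ρ := funext fun _ => hρb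
  rw [hfun, ← ENNReal.ofReal_toReal hρw, ← ENNReal.ofReal_pow (by positivity),
    ← ENNReal.ofReal_mul (by positivity), ← ENNReal.ofReal_add (by positivity) (by positivity)]
  refine ENNReal.ofReal_le_ofReal ?_
  have hy1 : 0 ≤ t ^ (q + 1) * y := by positivity
  have h1 : (y / b) ^ 2 * Z = Z / b ^ 2 * y ^ 2 := by rw [div_pow]; ring
  rw [← hZ, h1]
  have h2 : 0 ≤ Z / b ^ 2 := by positivity
  nlinarith [mul_nonneg h2 hy1, mul_nonneg hKs (sq_nonneg y), sq_nonneg y]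

end Jets

/-! ### Homogeneous parts, graded sizes and the choice of constants -/

section HomogeneousParts

variable {𝕜 : Type*} [RCLike 𝕜] {n r s : ℕ} {m : Fin r → ℕ}

theorem homNorm_neg (d : ℕ) (f : MvPowerSeries (Fin n) 𝕜) : homNorm d (-f) = homNorm d f := by
  simp [homNorm]

theorem homNorm_sum_le {ι : Type*} (t : Finset ι) (d : ℕ) (f : ι → MvPowerSeries (Fin n) 𝕜) :
    homNorm d (∑ i ∈ t, f i) ≤ ∑ i ∈ t, homNorm d (f i) := by
  classical
  induction t using Finset.induction_on with
  | empty => simp [homNorm_zero]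
  | insert a t ha ih =>
    rw [Finset.sum_insert ha, Finset.sum_insert ha]
    exact (homNorm_add_le _ _ _).trans (by gcongr)

theorem homNorm_eq_of_lt_order_sub {d : ℕ} {f g : MvPowerSeries (Fin n) 𝕜}
    (h : (d : ℕ∞) < (f - g).order) : homNorm d f = homNorm d g := by
  refine Finset.sum_congr rfl fun α hα => ?_
  rw [← degree_of_mem_antidiag hα] at h
  have := coeff_of_lt_order h
  rw [map_sub, sub_eq_zero] at this
  rw [this]

theorem homNorm_homogeneousComponent (d : ℕ) (f : MvPowerSeries (Fin n) 𝕜) :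
    homNorm d (homogeneousComponent d f) = homNorm d f := by
  refine Finset.sum_congr rfl fun α hα => ?_
  rw [coeff_homogeneousComponent, if_pos (degree_of_mem_antidiag hα)]

theorem tupleNorm_le_sum (d : ℕ) (f : FormalTuple 𝕜 n s) :
    tupleNorm d f ≤ ∑ l, homNorm d (f l) := by
  unfold tupleNorm
  refine Real.iSup_le (fun l => ?_) (Finset.sum_nonneg fun l _ => homNorm_nonneg d _)
  exact Finset.single_le_sum (f := fun l => homNorm d (f l)) (fun l _ => homNorm_nonneg d _)
    (Finset.mem_univ l)

theorem homPart_add (d : ℕ) (f g : FormalTuple 𝕜 n s) :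
    homPart d (f + g) = homPart d f + homPart d g := by
  apply Subtype.ext; funext l
  exact map_add (homogeneousComponent d) (f l) (g l)

theorem homPart_of_mem {d : ℕ} {f : FormalTuple 𝕜 n s} (hf : f ∈ AHom 𝕜 n s d) :
    homPart d f = ⟨f, hf⟩ := by
  apply Subtype.ext; funext l
  exact (isHomogeneous_iff_eq_homogeneousComponent.1 (hf l)).symm

theorem homPart_eq_of_sub_mem {d e : ℕ} (hde : d ≤ e) {f g : FormalTuple 𝕜 n s}
    (h : f - g ∈ formalGT 𝕜 n fun _ : Fin s => e) : homPart d f = homPart d g := by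
  apply Subtype.ext; funext l
  ext α
  change coeff α (homogeneousComponent d (f l)) = coeff α (homogeneousComponent d (g l))
  rw [coeff_homogeneousComponent, coeff_homogeneousComponent]
  split_ifs with hα
  · have := coeff_of_lt_order (lt_of_le_of_lt (b := (e : ℕ∞)) (by rw [hα]; exact_mod_cast hde)
      (h l))
    rw [Pi.sub_apply, map_sub, sub_eq_zero] at this
    exact this
  · rfl

theorem FHom_le_FGT_of_lt {i k : ℕ} (h : i < k) : FHom 𝕜 n m k ≤ FGT 𝕜 n m i := by
  intro F hF
  refine ⟨fun j => IsConvergent.of_isHomogeneous (hF j), fun j => ?_⟩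
  have h1 : m j + i < m j + k := by omega
  refine lt_of_lt_of_le (b := ((m j + k : ℕ) : ℕ∞)) (by exact_mod_cast h1) ?_
  exact nat_le_order fun α hα => IsHomogeneous.coeff_eq_zero (hF j) hα.ne

theorem homPart_eq_zero_of_mem {d e : ℕ} (hde : d ≠ e) {f : FormalTuple 𝕜 n s}
    (hf : f ∈ AHom 𝕜 n s e) : homPart d f = 0 := by
  apply Subtype.ext; funext l
  ext α
  change coeff α (homogeneousComponent d (f l)) = coeff α 0
  rw [coeff_homogeneousComponent]
  split_ifs with hα
  · rw [IsHomogeneous.coeff_eq_zero (hf l) (by rw [hα]; exact hde), map_zero]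
  · rw [map_zero]

/-- The size of an element of `𝓕^{(i)}`, weighted as in the big denominators condition. -/
def gradedSize (m : Fin r → ℕ) (i : ℕ) (F : FormalTuple 𝕜 n r) : ℝ :=
  ∑ j, (i : ℝ) ^ m j * homNorm (m j + i) (F j)

theorem gradedSize_nonneg (i : ℕ) (F : FormalTuple 𝕜 n r) : 0 ≤ gradedSize m i F :=
  Finset.sum_nonneg fun _ _ => mul_nonneg (by positivity) (homNorm_nonneg _ _)

theorem le_gradedSize (i : ℕ) (F : FormalTuple 𝕜 n r) (j : Fin r) :
    (i : ℝ) ^ m j * homNorm (m j + i) (F j) ≤ gradedSize m i F :=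
  Finset.single_le_sum (f := fun j => (i : ℝ) ^ m j * homNorm (m j + i) (F j))
    (fun _ _ => mul_nonneg (by positivity) (homNorm_nonneg _ _)) (Finset.mem_univ j)

/-- The growth `i^{m_j}` caused by differentiation is already contained in `gradedSize`, so `c` is
independent of the degrees involved. -/
theorem exists_wnorm_iterPDeriv_sum_le (m : Fin r → ℕ) : ∃ c : ℝ, 0 < c ∧
    ∀ E : ℕ → FormalTuple 𝕜 n r, (∀ k, E k ∈ FHom 𝕜 n m (k + 1)) → ∀ (I : Finset ℕ)
      (u : JetCoord n m) (t : ℝ), 0 ≤ t →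
      wnorm (fun _ => ENNReal.ofReal t) (iterPDeriv u.2.1 ((∑ k ∈ I, E k) u.1)) ≤
        ENNReal.ofReal (t ^ (m u.1 - u.2.1.degree) *
          (c * ∑ k ∈ I, t ^ (k + 1) * gradedSize m (k + 1) (E k))) := by
  have hs : ∀ j, ((m j : ℝ) + 1) ^ m j ≤ ∑ j, ((m j : ℝ) + 1) ^ m j := fun j =>
    Finset.single_le_sum (f := fun j => ((m j : ℝ) + 1) ^ m j) (fun _ _ => by positivity)
      (Finset.mem_univ j)
  refine ⟨∑ j, ((m j : ℝ) + 1) ^ m j + 1, by positivity, fun E hE I u t ht => ?_⟩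
  have h0 : ∀ k, 0 ≤ t ^ (k + 1) * gradedSize m (k + 1) (E k) := fun k =>
    mul_nonneg (by positivity) (gradedSize_nonneg _ _)
  rw [Finset.sum_apply, iterPDeriv_sum, Finset.mul_sum, Finset.mul_sum,
    ENNReal.ofReal_sum_of_nonneg fun k _ =>
      mul_nonneg (by positivity) (mul_nonneg (by positivity) (h0 k))]
  refine (wnorm_sum_le _ _ _).trans (Finset.sum_le_sum fun k _ => ?_)
  refine (wnorm_iterPDeriv_le (Nat.le_add_left 1 k) (hE k u.1) u.2.2 ht).trans ?_
  refine ENNReal.ofReal_le_ofReal ?_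
  have h1 := le_gradedSize (m := m) (k + 1) (E k) u.1
  calc ((m u.1 : ℝ) + 1) ^ m u.1 * t ^ (m u.1 - u.2.1.degree) *
        (t ^ (k + 1) * (((k + 1 : ℕ) : ℝ) ^ m u.1 * homNorm (m u.1 + (k + 1)) (E k u.1)))
      ≤ (∑ j, ((m j : ℝ) + 1) ^ m j + 1) * t ^ (m u.1 - u.2.1.degree) *
        (t ^ (k + 1) * gradedSize m (k + 1) (E k)) := by
        have := homNorm_nonneg (m u.1 + (k + 1)) (E k u.1)
        have := hs u.1
        gcongr
        linarith
    _ = _ := by ring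

/-- The reciprocal of `1 + ∑ 1 / f i` serves in place of a minimum and also covers an empty index
type. -/
theorem exists_pos_forall_le {ι : Type*} [Fintype ι] {f : ι → ℝ} (hf : ∀ i, 0 < f i) :
    ∃ b : ℝ, 0 < b ∧ ∀ i, b ≤ f i := by
  have h0 : 0 ≤ ∑ i, (f i)⁻¹ := Finset.sum_nonneg fun i _ => (inv_pos.2 (hf i)).le
  refine ⟨(∑ i, (f i)⁻¹ + 1)⁻¹, by positivity, fun i => ?_⟩
  have h1 : (f i)⁻¹ ≤ ∑ i, (f i)⁻¹ := Finset.single_le_sum (f := fun i => (f i)⁻¹)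
    (fun i _ => (inv_pos.2 (hf i)).le) (Finset.mem_univ i)
  rw [inv_le_comm₀ (by positivity) (hf i)]
  linarith

/-- The order of choice matters. First `η` is taken so small that the quadratic term uses at most
half of `η t^{2q}`; then `t`, depending on `η`, makes the other two terms, which have a spare factor
`t`, fit into the other half. -/
theorem exists_small_radius {D c b t₀ : ℝ} (hD : 0 < D) (hc : 0 < c) (hb : 0 < b) (ht₀ : 0 < t₀)
    (q : ℕ) : ∃ t η : ℝ, 0 < t ∧ t ≤ t₀ ∧ 0 < η ∧ c * (η * t ^ q) ≤ b ∧
      ∀ g, 0 ≤ g → g ≤ η * t ^ q →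
        D * (t ^ (2 * q + 1) + t ^ (q + 1) * (c * g) + (c * g) ^ 2) ≤ t ^ q * (η * t ^ q) := by
  obtain ⟨η, hη, hη1, hη2⟩ : ∃ η : ℝ, 0 < η ∧ c * η ≤ b ∧ D * c ^ 2 * η ≤ 1 / 2 := by
    refine ⟨min (b / c) (1 / (2 * (D * c ^ 2))), by positivity, ?_, ?_⟩
    · calc c * min (b / c) (1 / (2 * (D * c ^ 2))) ≤ c * (b / c) := by gcongr; exact min_le_left _ _
        _ = b := by field_simp
    · calc D * c ^ 2 * min (b / c) (1 / (2 * (D * c ^ 2)))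
          ≤ D * c ^ 2 * (1 / (2 * (D * c ^ 2))) := by gcongr; exact min_le_right _ _
        _ = 1 / 2 := by field_simp
  obtain ⟨t, ht, htt, ht1, ht2⟩ : ∃ t : ℝ, 0 < t ∧ t ≤ t₀ ∧ t ≤ 1 ∧
      t * (D * (1 + c * η)) ≤ η / 2 := by
    refine ⟨min t₀ (min 1 (η / 2 / (D * (1 + c * η)))), by positivity, min_le_left _ _,
      (min_le_right _ _).trans (min_le_left _ _), ?_⟩
    rw [← le_div_iff₀ (by positivity)]
    exact (min_le_right _ _).trans (min_le_right _ _)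
  have htq : t ^ q ≤ 1 := pow_le_one₀ ht.le ht1
  refine ⟨t, η, ht, htt, hη, ?_, fun g hg hgη => ?_⟩
  · calc c * (η * t ^ q) ≤ c * (η * 1) := by gcongr
      _ ≤ b := by linarith
  · calc D * (t ^ (2 * q + 1) + t ^ (q + 1) * (c * g) + (c * g) ^ 2)
        ≤ D * (t ^ (2 * q + 1) + t ^ (q + 1) * (c * (η * t ^ q)) + (c * (η * t ^ q)) ^ 2) := by
          gcongr
      _ = t ^ q * t ^ q * (t * (D * (1 + c * η)) + D * c ^ 2 * η * η) := by ring
      _ ≤ t ^ q * t ^ q * (η / 2 + 1 / 2 * η) := by gcongr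
      _ = _ := by ring

end HomogeneousParts

/-! ### Formal solution, geometric bounds and the limit -/

section Solution

variable {𝕜 : Type*} [RCLike 𝕜] {n r s q : ℕ} {m : Fin r → ℕ} {P : FormalTuple 𝕜 n s}
  {act : FGT 𝕜 n m 0 → AffineGerms q P → AffineGerms q P}
  {S : FGT 𝕜 n m 0 →ₗ[𝕜] analyticTuples 𝕜 n s}

/-- The nonlinear terms `R + 𝓣(R; F)` of the normal form equation. -/
def residual (act : FGT 𝕜 n m 0 → AffineGerms q P → AffineGerms q P)
    (S : FGT 𝕜 n m 0 →ₗ[𝕜] analyticTuples 𝕜 n s) (X : AffineGerms q P) (F : FGT 𝕜 n m 0) :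
    FormalTuple 𝕜 n s :=
  (X.1 - P) + remainder act S X F

/-- Degree by degree solution of the normal form equation. -/
theorem exists_approximations (hfilt : IsFiltering act S)
    {N : ∀ i : ℕ, Submodule 𝕜 (AHom 𝕜 n s (q + i))}
    (hN : ∀ (i : ℕ) (hi : 1 ≤ i), IsCompl (LinearMap.range (hfilt.gradedMap i hi)) (N i))
    {C : ℝ} (hC0 : 0 ≤ C) (hC : ∀ (i : ℕ) (hi : 1 ≤ i) (A : AHom 𝕜 n s (q + i)),
      ∃ F : FHom 𝕜 n m i,
        hfilt.gradedMap i hi F =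
          Submodule.projection (LinearMap.range (hfilt.gradedMap i hi)) (N i) (hN i hi) A ∧
        ∀ j : Fin r, homNorm (m j + i) (F.1 j) ≤ C * tupleNorm (q + i) A.1 / (i : ℝ) ^ m j)
    (X : AffineGerms q P) :
    ∃ Φ : ℕ → FGT 𝕜 n m 0, Φ 0 = 0 ∧ ∀ k,
      (Φ (k + 1) - Φ k).1 ∈ FHom 𝕜 n m (k + 1) ∧
      (∀ j, homNorm (m j + (k + 1)) ((Φ (k + 1) - Φ k).1 j) ≤
        C * (∑ l, homNorm (q + (k + 1)) (residual act S X (Φ k) l)) /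
          ((k + 1 : ℕ) : ℝ) ^ m j) ∧
      homPart (q + (k + 1)) (S (Φ (k + 1) - Φ k)).1 +
        homPart (q + (k + 1)) (residual act S X (Φ k)) ∈ N (k + 1) := by
  have hstep : ∀ (k : ℕ) (F : FGT 𝕜 n m 0), ∃ G : FGT 𝕜 n m 0,
      (G - F).1 ∈ FHom 𝕜 n m (k + 1) ∧
      (∀ j, homNorm (m j + (k + 1)) ((G - F).1 j) ≤
        C * (∑ l, homNorm (q + (k + 1)) (residual act S X F l)) / ((k + 1 : ℕ) : ℝ) ^ m j) ∧
      homPart (q + (k + 1)) (S (G - F)).1 +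
        homPart (q + (k + 1)) (residual act S X F) ∈ N (k + 1) := by
    intro k F
    have hk : 1 ≤ k + 1 := Nat.le_add_left 1 k
    set A := homPart (q + (k + 1)) (residual act S X F) with hA
    obtain ⟨H, hH, hHn⟩ := hC (k + 1) hk A
    -- Since `𝓢 H` is the projection of `A` to the image, the increment `-H` leaves `A - 𝓢 H`, the
    -- component of `A` in `N (k + 1)`.
    refine ⟨F - ⟨H.1, FHom_le_FGT 𝕜 n m hk H.2⟩, ?_, fun j => ?_, ?_⟩
    · rw [sub_sub_cancel_left]
      exact neg_mem H.2
    · rw [sub_sub_cancel_left]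
      refine (homNorm_neg _ (H.1 j)).le.trans ((hHn j).trans ?_)
      gcongr ?_ / _
      refine mul_le_mul_of_nonneg_left ?_ hC0
      refine (tupleNorm_le_sum (q + (k + 1)) A.1).trans
        (le_of_eq (Finset.sum_congr rfl fun l _ => ?_))
      exact homNorm_homogeneousComponent _ (residual act S X F l)
    · rw [sub_sub_cancel_left, map_neg]
      have h1 : homPart (q + (k + 1))
          (-S ⟨H.1, FHom_le_FGT 𝕜 n m hk H.2⟩ : analyticTuples 𝕜 n s).1 =
          -hfilt.gradedMap (k + 1) hk H :=
        homPart_of_mem (neg_mem (hfilt.map_hom (k + 1) hk ⟨H.1, FHom_le_FGT 𝕜 n m hk H.2⟩ H.2))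
      have h2 := Submodule.projection_add_projection_eq_self (hN (k + 1) hk) A
      rw [h1, hH, neg_add_eq_sub, sub_eq_of_eq_add' h2.symm]
      exact Submodule.projection_apply_mem _ _
  choose G hG using hstep
  exact ⟨fun k => Nat.rec 0 G k, rfl, fun k => hG k _⟩

/-- Stability of the residual in low degrees. -/
theorem residual_sub_mem (hfilt : IsFiltering act S) (X : AffineGerms q P) {F G : FGT 𝕜 n m 0}
    {i : ℕ} (h : F.1 - G.1 ∈ FGT 𝕜 n m i) :
    residual act S X F - residual act S X G ∈ formalGT 𝕜 n fun _ : Fin s => q + (i + 1) := by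
  have := hfilt.remainder_sub X F G i h
  rwa [residual, residual, add_sub_add_left_eq_sub]

theorem sub_mem_FGT {Φ : ℕ → FGT 𝕜 n m 0}
    (hΦ : ∀ k, (Φ (k + 1) - Φ k).1 ∈ FHom 𝕜 n m (k + 1)) {i k : ℕ} (h : i ≤ k) :
    (Φ k).1 - (Φ i).1 ∈ FGT 𝕜 n m i := by
  induction k, h using Nat.le_induction with
  | base => rw [sub_self]; exact zero_mem _
  | succ k hk ih =>
    have := add_mem (FHom_le_FGT_of_lt (Nat.lt_succ_of_le hk) (hΦ k)) ih
    simpa using this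

/-- The approximations grow at most geometrically. -/
theorem exists_gradedSize_le (hfilt : IsFiltering act S)
    (hdiff : IsRegularAnalyticDifferential act S)
    (X : AffineGerms q P) {Φ : ℕ → FGT 𝕜 n m 0} (hΦ0 : Φ 0 = 0)
    (hΦ : ∀ k, (Φ (k + 1) - Φ k).1 ∈ FHom 𝕜 n m (k + 1)) {C : ℝ} (hC0 : 0 < C)
    (hC : ∀ k j, homNorm (m j + (k + 1)) ((Φ (k + 1) - Φ k).1 j) ≤
        C * (∑ l, homNorm (q + (k + 1)) (residual act S X (Φ k) l)) /
          ((k + 1 : ℕ) : ℝ) ^ m j) :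
    ∃ t M : ℝ, 0 < t ∧ ∀ k, t ^ (k + 1) * gradedSize m (k + 1) (Φ (k + 1) - Φ k).1 ≤ M := by
  classical
  obtain ⟨W, hW, hWreg⟩ := hdiff X
  obtain ⟨c₁, hc₁, hder⟩ := exists_wnorm_iterPDeriv_sum_le (𝕜 := 𝕜) (n := n) m
  set E : ℕ → FormalTuple 𝕜 n r := fun k => (Φ (k + 1) - Φ k).1 with hE
  have hsum : ∀ N, q ≤ N → (Φ N).1 = (Φ q).1 + ∑ k ∈ Finset.Ico q N, E k := by
    intro N hN
    have := Finset.sum_Ico_sub (fun k => (Φ k).1) hN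
    rw [show ∑ k ∈ Finset.Ico q N, E k = (Φ N).1 - (Φ q).1 from this]
    abel
  have hsum0 : (Φ q).1 = ∑ k ∈ Finset.range q, E k := by
    have := Finset.sum_range_sub (fun k => (Φ k).1) q
    rw [hΦ0] at this
    rw [show ∑ k ∈ Finset.range q, E k = (Φ q).1 - 0 from this, sub_zero]
  have hmem : ∀ F : FGT 𝕜 n m 0, F.1 ∈ formalGT 𝕜 n m := fun F => F.2.2
  -- `Φ q` is a finite sum of homogeneous tuples, so its jet has finite norm at every radius, in
  -- particular at `1`.
  have hfin : ∀ v, wnorm (fun _ => 1) (jet m (Φ q).1 v) ≠ ∞ := by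
    rintro (i | u)
    · simp [jet, wnorm_X]
    · have := hder E hΦ (Finset.range q) u 1 zero_le_one
      rw [← hsum0, ENNReal.ofReal_one] at this
      exact ne_top_of_le_ne_top ENNReal.ofReal_ne_top this
  have hres : ∀ k l, residual act S X (Φ k) l = (X.1 - P) l + evalJet (W l) (Φ k).1 := by
    intro k l
    simp only [residual, remainder, Pi.add_apply, Pi.sub_apply, hW.act_eq]
    ring
  -- Only increments with index at least `q` are counted: they solve equations in degrees at least
  -- `2q + 1`, where the residual at `Φ q` is `O(t^{2q+1})`.
  set g : ℝ → ℕ → ℝ := fun t N =>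
    ∑ k ∈ Finset.Ico q N, t ^ (k + 1) * gradedSize m (k + 1) (E k) with hg
  have hg0 : ∀ t N, 0 ≤ t → 0 ≤ g t N := fun t N ht => Finset.sum_nonneg fun k _ =>
    mul_nonneg (by positivity) (gradedSize_nonneg _ _)
  have hcomp : ∀ l : Fin s, ∃ c t₀ b : ℝ, 0 < c ∧ 0 < t₀ ∧ 0 < b ∧ ∀ t N, 0 < t → t ≤ t₀ →
      q ≤ N → c₁ * g t N ≤ b →
      ∑ k ∈ Finset.Ico q (N + 1), t ^ (q + (k + 1)) *
        homNorm (q + (k + 1)) (residual act S X (Φ N) l) ≤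
      c * (t ^ (2 * q + 1) + t ^ (q + 1) * (c₁ * g t N) + (c₁ * g t N) ^ 2) := by
    intro l
    obtain ⟨c, t₀, b, hc, ht₀, -, hb, hfin₀, hmain⟩ :=
      exists_wnorm_evalJet_sub_le (hW.convergent l) (hmem (Φ q)) hfin
        (fun u => hWreg _ (hmem (Φ q)) l u)
    obtain ⟨t₁, ht₁, hfin₁⟩ := IsConvergent.exists_wnorm_ne_top (X.2.1 l)
    have hfin₂ : wnorm (fun _ => ENNReal.ofReal (min t₀ t₁)) (residual act S X (Φ q) l) ≠ ∞ := by
      rw [hres]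
      refine ne_top_of_le_ne_top (ENNReal.add_ne_top.2 ⟨?_, ?_⟩) (wnorm_add_le _ _ _)
      · exact ne_top_of_le_ne_top hfin₁
          (wnorm_mono (fun _ => ENNReal.ofReal_le_ofReal (min_le_right _ _)) _)
      · exact ne_top_of_le_ne_top hfin₀
          (wnorm_mono (fun _ => ENNReal.ofReal_le_ofReal (min_le_left _ _)) _)
    obtain ⟨K, hK0, hK⟩ := sum_homNorm_le_of_wnorm_ne_top (lt_min ht₀ ht₁) hfin₂ (2 * q + 1)
    refine ⟨K + c, min t₀ t₁, b, by positivity, lt_min ht₀ ht₁, hb, fun t N ht htt hN hgb => ?_⟩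
    have hgN := hg0 t N ht.le
    have hincr := hmain t (c₁ * g t N) ht (htt.trans (min_le_left _ _)) (by positivity) hgb
      (∑ k ∈ Finset.Ico q N, E k)
      (sum_mem fun k _ => (FHom_le_FGT 𝕜 n m (Nat.le_add_left 1 k) (hΦ k)).2)
      (fun u => hder E hΦ (Finset.Ico q N) u t ht.le)
    rw [← hsum N hN] at hincr
    have hinj : Set.InjOn (fun k => q + (k + 1)) (Finset.Ico q (N + 1) : Set ℕ) :=
      fun a _ b _ h => by simpa using h
    have hD := (sum_homNorm_le_wnorm ht.le
      ((Finset.Ico q (N + 1)).image fun k => q + (k + 1)) _).trans hincr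
    rw [ENNReal.ofReal_le_ofReal_iff (by positivity), Finset.sum_image hinj] at hD
    have hR := hK t ht.le htt ((Finset.Ico q (N + 1)).image fun k => q + (k + 1)) (by
      intro d hd
      obtain ⟨k, hk, rfl⟩ := Finset.mem_image.1 hd
      have := (Finset.mem_Ico.1 hk).1
      omega)
    rw [Finset.sum_image hinj] at hR
    have hsplit : residual act S X (Φ N) l = residual act S X (Φ q) l +
        (evalJet (W l) (Φ N).1 - evalJet (W l) (Φ q).1) := by
      rw [hres, hres]; ring
    calc ∑ k ∈ Finset.Ico q (N + 1), t ^ (q + (k + 1)) *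
          homNorm (q + (k + 1)) (residual act S X (Φ N) l)
        ≤ ∑ k ∈ Finset.Ico q (N + 1), (t ^ (q + (k + 1)) *
          homNorm (q + (k + 1)) (residual act S X (Φ q) l) + t ^ (q + (k + 1)) *
          homNorm (q + (k + 1)) (evalJet (W l) (Φ N).1 - evalJet (W l) (Φ q).1)) := by
          refine Finset.sum_le_sum fun k _ => ?_
          rw [← mul_add, hsplit]
          gcongr
          exact homNorm_add_le _ _ _
      _ ≤ K * t ^ (2 * q + 1) + c * (t ^ (q + 1) * (c₁ * g t N) + (c₁ * g t N) ^ 2) := by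
          rw [Finset.sum_add_distrib]
          exact add_le_add hR hD
      _ ≤ _ := by
          have h1 : 0 ≤ t ^ (q + 1) * (c₁ * g t N) + (c₁ * g t N) ^ 2 := by positivity
          have h2 : 0 ≤ t ^ (2 * q + 1) := by positivity
          nlinarith [mul_nonneg hK0 h1, mul_nonneg hc.le h2]
  choose c t₀ b hc ht₀ hb hcomp using hcomp
  obtain ⟨t₁, ht₁, ht₁le⟩ := exists_pos_forall_le ht₀
  obtain ⟨b₁, hb₁, hb₁le⟩ := exists_pos_forall_le hb
  have hcs : 0 ≤ ∑ l, c l := Finset.sum_nonneg fun l _ => (hc l).le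
  have hstep : ∀ t N, 0 < t → t ≤ t₁ → q ≤ N → c₁ * g t N ≤ b₁ →
      t ^ q * g t (N + 1) ≤ ((r : ℝ) * C * ∑ l, c l + 1) *
        (t ^ (2 * q + 1) + t ^ (q + 1) * (c₁ * g t N) + (c₁ * g t N) ^ 2) := by
    intro t N ht htt hN hgb
    have hgN := hg0 t N ht.le
    have hsize : ∀ k ∈ Finset.Ico q (N + 1), gradedSize m (k + 1) (E k) ≤
        (r : ℝ) * C * ∑ l, homNorm (q + (k + 1)) (residual act S X (Φ N) l) := by
      intro k hk
      have hkN : k ≤ N := Nat.lt_succ_iff.1 (Finset.mem_Ico.1 hk).2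
      -- In degree `q + (k+1)` the residuals at `Φ k` and `Φ N` agree, so one estimate of the
      -- residual at `Φ N` bounds all increments up to index `N`.
      have hrw : ∀ l, homNorm (q + (k + 1)) (residual act S X (Φ k) l) =
          homNorm (q + (k + 1)) (residual act S X (Φ N) l) := fun l =>
        (homNorm_eq_of_lt_order_sub (residual_sub_mem hfilt X (sub_mem_FGT hΦ hkN) l)).symm
      have hj : ∀ j ∈ (Finset.univ : Finset (Fin r)),
          ((k + 1 : ℕ) : ℝ) ^ m j * homNorm (m j + (k + 1)) (E k j) ≤
          C * ∑ l, homNorm (q + (k + 1)) (residual act S X (Φ N) l) := by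
        intro j _
        have := hC k j
        rw [le_div_iff₀ (by positivity), Finset.sum_congr rfl fun l _ => hrw l] at this
        rwa [mul_comm]
      refine (Finset.sum_le_card_nsmul _ _ _ hj).trans (le_of_eq ?_)
      rw [Finset.card_univ, Fintype.card_fin, nsmul_eq_mul, mul_assoc]
    calc t ^ q * g t (N + 1)
        = ∑ k ∈ Finset.Ico q (N + 1), t ^ (q + (k + 1)) * gradedSize m (k + 1) (E k) := by
          rw [hg, Finset.mul_sum]
          exact Finset.sum_congr rfl fun k _ => by rw [pow_add t q]; ring
      _ ≤ ∑ k ∈ Finset.Ico q (N + 1), t ^ (q + (k + 1)) *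
          ((r : ℝ) * C * ∑ l, homNorm (q + (k + 1)) (residual act S X (Φ N) l)) := by
          refine Finset.sum_le_sum fun k hk => ?_
          gcongr
          exact hsize k hk
      _ = (r : ℝ) * C * ∑ l, ∑ k ∈ Finset.Ico q (N + 1), t ^ (q + (k + 1)) *
          homNorm (q + (k + 1)) (residual act S X (Φ N) l) := by
          rw [Finset.sum_comm, Finset.mul_sum]
          refine Finset.sum_congr rfl fun k _ => ?_
          rw [Finset.mul_sum, Finset.mul_sum, Finset.mul_sum]
          exact Finset.sum_congr rfl fun l _ => by ring
      _ ≤ (r : ℝ) * C * ∑ l, c l *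
          (t ^ (2 * q + 1) + t ^ (q + 1) * (c₁ * g t N) + (c₁ * g t N) ^ 2) := by
          gcongr with l
          exact hcomp l t N ht (htt.trans (ht₁le l)) hN (hgb.trans (hb₁le l))
      _ ≤ _ := by
          rw [← Finset.sum_mul, ← mul_assoc]
          gcongr
          linarith
  obtain ⟨t, η, ht, htt, hη, hsmall, hind⟩ := exists_small_radius
    (D := (r : ℝ) * C * ∑ l, c l + 1) (by positivity) hc₁ hb₁ ht₁ q
  have hbound : ∀ N, q ≤ N → g t N ≤ η * t ^ q := by
    intro N hN
    induction N, hN using Nat.le_induction with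
    | base =>
      simp only [hg, Finset.Ico_self, Finset.sum_empty]
      positivity
    | succ N hN ih =>
      have h1 : c₁ * g t N ≤ b₁ := le_trans (by gcongr) hsmall
      -- The factor `t^q`, coming from the shift of degree by `q` under `𝓢`, is cancelled.
      exact le_of_mul_le_mul_left
        ((hstep t N ht htt hN h1).trans (hind _ (hg0 t N ht.le) ih)) (pow_pos ht q)
  have hnn : ∀ k, 0 ≤ t ^ (k + 1) * gradedSize m (k + 1) (E k) := fun k =>
    mul_nonneg (by positivity) (gradedSize_nonneg _ _)
  refine ⟨t, η * t ^ q + ∑ k ∈ Finset.range q, t ^ (k + 1) * gradedSize m (k + 1) (E k), ht,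
    fun k => ?_⟩
  by_cases hk : k < q
  · have := Finset.single_le_sum (f := fun k => t ^ (k + 1) * gradedSize m (k + 1) (E k))
      (fun k _ => hnn k) (Finset.mem_range.2 hk)
    have h2 : 0 ≤ η * t ^ q := by positivity
    exact this.trans (by linarith)
  · have h1 := Finset.single_le_sum (f := fun k => t ^ (k + 1) * gradedSize m (k + 1) (E k))
      (fun k _ => hnn k) (Finset.mem_Ico.2 ⟨not_lt.1 hk, Nat.lt_succ_self k⟩)
    have h2 := hbound (k + 1) (by omega)
    have h3 : 0 ≤ ∑ k ∈ Finset.range q, t ^ (k + 1) * gradedSize m (k + 1) (E k) :=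
      Finset.sum_nonneg fun k _ => hnn k
    exact h1.trans (h2.trans (by linarith))

/-- The limit of the approximations. -/
theorem exists_limit {Φ : ℕ → FGT 𝕜 n m 0} (hΦ0 : Φ 0 = 0)
    (hΦ : ∀ k, (Φ (k + 1) - Φ k).1 ∈ FHom 𝕜 n m (k + 1)) {t M : ℝ} (ht : 0 < t)
    (hM : ∀ k, t ^ (k + 1) * gradedSize m (k + 1) (Φ (k + 1) - Φ k).1 ≤ M) :
    ∃ F : FGT 𝕜 n m 0, ∀ i, F.1 - (Φ i).1 ∈ FGT 𝕜 n m i := by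
  set E : ℕ → FormalTuple 𝕜 n r := fun k => (Φ (k + 1) - Φ k).1 with hE
  have hsum : ∀ i, (Φ i).1 = ∑ k ∈ Finset.range i, E k := by
    intro i
    have := Finset.sum_range_sub (fun k => (Φ k).1) i
    rw [hΦ0] at this
    rw [show ∑ k ∈ Finset.range i, E k = (Φ i).1 - 0 from this, sub_zero]
  have hstab : ∀ {i k : ℕ}, i ≤ k → ∀ (j : Fin r) (α : Fin n →₀ ℕ), α.degree ≤ m j + i →
      coeff α ((Φ k).1 j) = coeff α ((Φ i).1 j) := by
    intro i k hik j α hα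
    have h1 := coeff_of_lt_order (lt_of_le_of_lt (b := ((m j + i : ℕ) : ℕ∞))
      (by exact_mod_cast hα) ((sub_mem_FGT hΦ hik).2 j))
    rwa [Pi.sub_apply, map_sub, sub_eq_zero] at h1
  -- The coefficient at `α` is final from `Φ |α|` on, because `|α| ≤ m_j + |α|`.
  let F : FormalTuple 𝕜 n r := fun j α => coeff α ((Φ α.degree).1 j)
  have hF : ∀ i j (α : Fin n →₀ ℕ), α.degree ≤ m j + i →
      coeff α (F j) = coeff α ((Φ i).1 j) := by
    intro i j α hα
    change coeff α ((Φ α.degree).1 j) = _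
    rcases le_total i α.degree with h | h
    · exact hstab h j α hα
    · exact (hstab h j α (Nat.le_add_left _ _)).symm
  have hord : ∀ i, F - (Φ i).1 ∈ formalGT 𝕜 n fun j => m j + i := by
    intro i j
    refine lt_of_lt_of_le (b := ((m j + i + 1 : ℕ) : ℕ∞)) (by exact_mod_cast Nat.lt_succ_self _)
      (nat_le_order fun α hα => ?_)
    rw [Pi.sub_apply, map_sub, hF i j α (Nat.lt_succ_iff.1 hα), sub_self]
  have hM0 : 0 ≤ M := le_trans (mul_nonneg (by positivity) (gradedSize_nonneg _ _)) (hM 0)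
  have hconv : F ∈ analyticTuples 𝕜 n r := by
    intro j
    -- A radius at most `1` allows the exponent `k + 1` to be raised to the actual degree `m_j +
    -- (k+1)`.
    have hρ : 0 < min t 1 := by positivity
    have hρ1 : 1 ≤ 1 / min t 1 := by rw [le_div_iff₀ hρ, one_mul]; exact min_le_right _ _
    refine ⟨M + 1, min t 1, by positivity, hρ, fun d => ?_⟩
    rcases le_or_gt d (m j) with hd | hd
    · have h0 : homNorm d (F j) = 0 := Finset.sum_eq_zero fun α hα => by
        rw [hF 0 j α (by rw [degree_of_mem_antidiag hα]; exact hd), hΦ0]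
        simp
      rw [h0]; positivity
    · obtain ⟨k, rfl⟩ : ∃ k, d = m j + (k + 1) := ⟨d - m j - 1, by omega⟩
      have h1 : homNorm (m j + (k + 1)) (F j) = homNorm (m j + (k + 1)) ((Φ (k + 1)).1 j) :=
        homNorm_eq_of_lt_order_sub (hord (k + 1) j)
      have h2 : homNorm (m j + (k + 1)) (F j) ≤ homNorm (m j + (k + 1)) (E k j) := by
        rw [h1, hsum, Finset.sum_apply]
        refine (homNorm_sum_le _ _ _).trans (le_of_eq ?_)
        refine Finset.sum_eq_single_of_mem k (Finset.self_mem_range_succ k) fun i _ hi => ?_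
        exact homNorm_eq_zero_of_isHomogeneous (hΦ i j) (by beta_reduce; omega)
      have h3 : homNorm (m j + (k + 1)) (E k j) ≤ gradedSize m (k + 1) (E k) := by
        refine le_trans ?_ (le_gradedSize (k + 1) (E k) j)
        refine le_mul_of_one_le_left (homNorm_nonneg _ _) (one_le_pow₀ ?_)
        exact_mod_cast Nat.le_add_left 1 k
      have h4 : gradedSize m (k + 1) (E k) ≤ M * (1 / t) ^ (k + 1) := by
        rw [one_div, inv_pow, ← div_eq_mul_inv, le_div_iff₀ (by positivity), mul_comm]
        exact hM k
      calc homNorm (m j + (k + 1)) (F j) ≤ M * (1 / t) ^ (k + 1) := h2.trans (h3.trans h4)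
        _ ≤ (M + 1) * (1 / min t 1) ^ (k + 1) := by
          gcongr
          · linarith
          · exact min_le_left _ _
        _ ≤ (M + 1) * (1 / min t 1) ^ (m j + (k + 1)) := by
          exact mul_le_mul_of_nonneg_left (pow_le_pow_right₀ hρ1 (by omega)) (by positivity)
  refine ⟨⟨F, hconv, ?_⟩, fun i => ⟨sub_mem hconv (Φ i).2.1, hord i⟩⟩
  have := hord 0
  rwa [hΦ0, ZeroMemClass.coe_zero, sub_zero] at this

/-- In degree `q + (k+1)` the linear term sees only the increment of index `k`: earlier ones map to
lower degrees, and the tail `F - Φ (k+1)` to higher ones. The residual at `F` may be replaced by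
that at `Φ k`, and what remains is the equation solved at step `k`. -/
theorem homPart_act_mem (hfilt : IsFiltering act S)
    {N : ∀ i : ℕ, Submodule 𝕜 (AHom 𝕜 n s (q + i))}
    (X : AffineGerms q P) {Φ : ℕ → FGT 𝕜 n m 0} (hΦ0 : Φ 0 = 0)
    (hΦ : ∀ k, (Φ (k + 1) - Φ k).1 ∈ FHom 𝕜 n m (k + 1)) (k : ℕ)
    (hk : homPart (q + (k + 1)) (S (Φ (k + 1) - Φ k)).1 +
        homPart (q + (k + 1)) (residual act S X (Φ k)) ∈ N (k + 1))
    {F : FGT 𝕜 n m 0} (hF : ∀ i, F.1 - (Φ i).1 ∈ FGT 𝕜 n m i) :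
    homPart (q + (k + 1)) ((act F X).1 - P) ∈ N (k + 1) := by
  have hk1 : 1 ≤ k + 1 := Nat.le_add_left 1 k
  set d := q + (k + 1) with hd
  have hact : (act F X).1 - P = (S F).1 + residual act S X F := by
    simp only [residual, remainder]; abel
  have hres : homPart d (residual act S X F) = homPart d (residual act S X (Φ k)) :=
    homPart_eq_of_sub_mem le_rfl (residual_sub_mem hfilt X (hF k))
  have hlin : ∀ G : FGT 𝕜 n m 0, ∀ i, k + 1 ≤ i → G.1 ∈ FGT 𝕜 n m i →
      homPart d (S G).1 = 0 := by
    intro G i hi hG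
    have h0 : homPart d (0 : FormalTuple 𝕜 n s) = 0 :=
      homPart_eq_zero_of_mem (Nat.succ_ne_self d).symm (zero_mem _)
    rw [← h0]
    refine homPart_eq_of_sub_mem (e := q + i) (by omega) ?_
    rw [sub_zero]
    exact (hfilt.map_gt i G hG).2
  have hlow : ∀ i, i ≤ k → homPart d (S (Φ i)).1 = 0 := by
    intro i
    induction i with
    | zero =>
      intro _
      rw [hΦ0, map_zero]
      exact homPart_eq_zero_of_mem (Nat.succ_ne_self d).symm (zero_mem _)
    | succ i ih =>
      intro hi
      have h1 : S (Φ (i + 1)) = S (Φ i) + S (Φ (i + 1) - Φ i) := by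
        rw [← map_add, add_sub_cancel]
      rw [h1, Submodule.coe_add, homPart_add, ih (by omega), zero_add]
      exact homPart_eq_zero_of_mem (by omega)
        (hfilt.map_hom (i + 1) (Nat.le_add_left 1 i) _ (hΦ i))
  have hSF : S F = S (F - Φ (k + 1)) + (S (Φ (k + 1) - Φ k) + S (Φ k)) := by
    rw [← map_add, ← map_add, sub_add_cancel, sub_add_cancel]
  rw [hact, homPart_add, hres, hSF, Submodule.coe_add, Submodule.coe_add, homPart_add,
    homPart_add, hlin (F - Φ (k + 1)) (k + 1) le_rfl (hF (k + 1)), hlow k le_rfl, zero_add,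
    add_zero]
  exact hk

end Solution

end AnalyticNormalForm
end

open AnalyticNormalForm
theorem theorem2p13 {𝕜 : Type*} [RCLike 𝕜] {n r s q : ℕ} (m : Fin r → ℕ)
    (P : FormalTuple 𝕜 n s) (hP : P ∈ AHom 𝕜 n s q)
    (act : FGT 𝕜 n m 0 → AffineGerms q P → AffineGerms q P)
    (S : FGT 𝕜 n m 0 →ₗ[𝕜] analyticTuples 𝕜 n s)
    (hfilt : IsFiltering act S)
    (hdiff : IsRegularAnalyticDifferential act S)
    (N : ∀ i : ℕ, Submodule 𝕜 (AHom 𝕜 n s (q + i)))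
    (hN : ∀ (i : ℕ) (hi : 1 ≤ i), IsCompl (LinearMap.range (hfilt.gradedMap i hi)) (N i))
    (hbig : ∃ C : ℝ, 0 < C ∧ ∀ (i : ℕ) (hi : 1 ≤ i) (A : AHom 𝕜 n s (q + i)),
      ∃ F : FHom 𝕜 n m i,
        hfilt.gradedMap i hi F =
          Submodule.projection (LinearMap.range (hfilt.gradedMap i hi)) (N i) (hN i hi) A ∧
        ∀ j : Fin r, homNorm (m j + i) (F.1 j) ≤ C * tupleNorm (q + i) A.1 / (i : ℝ) ^ m j) :
    HoldsInAnalyticCategory act N := by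
  obtain ⟨C, hC0, hC⟩ := hbig
  intro X
  obtain ⟨Φ, hΦ0, hΦ⟩ := exists_approximations hfilt hN hC0.le hC X
  obtain ⟨t, M, ht, hM⟩ := exists_gradedSize_le hfilt hdiff X hΦ0 (fun k => (hΦ k).1) hC0
    fun k => (hΦ k).2.1
  obtain ⟨F, hF⟩ := exists_limit hΦ0 (fun k => (hΦ k).1) ht hM
  refine ⟨F, ⟨(act F X).2.2, fun i hi => ?_⟩, (act F X).2⟩
  obtain ⟨k, rfl⟩ := Nat.exists_eq_add_of_le' hi
  exact homPart_act_mem hfilt X hΦ0 (fun k => (hΦ k).1) k (hΦ k).2.2 hF
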